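/- Let $k$ be a field of characteristic $p>0$ with $[k:k^p]<\infty$, let $n\ge 0$, let $R=k[x_0,\dots,x_n]$ with its standard grading, let $\mathfrak m=(x_0,\dots,x_n)$, and let $f\in R$ be homogeneous of degree $d$. A ring $A$ of characteristic $p$ is called F-pure if its Frobenius map $F:A\to A$, $a\mapsto a^p$, is pure, i.e. remains injective after tensoring with any $A$-module (the zero ring counts as F-pure). We say that $R/fR$ has an isolated non-F-pure point at $\mathfrak m$ if $(R/fR)_{\mathfrak m}$ is not F-pure but $(R/fR)_{\mathfrak p}$ is F-pure for every prime ideal $\mathfrak p\subsetneq\mathfrak m$ of $R$. The local cohomology module $H^n_{\mathfrak m}(R/fR)$ carries the $\mathbb Z$-grading and the Frobenius action $F$ induced by the grading and the Frobenius map of $R/fR$ (computed on the Čech complex of $R/fR$ on $x_0,\dots,x_n$); for $N\in\mathbb Z$ let $H^n_{\mathfrak m}(R/fR)_{\le N}$ be the sum of its components of degree $\le N$. Assume that $(R/fR)_{\mathfrak m}$ is not F-pure. Then $R/fR$ has an isolated non-F-pure point at $\mathfrak m$ if and only if the Frobenius action $$F: H^n_{\mathfrak m}(R/fR)_{\le -n(d-1)}\longrightarrow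 H^n_{\mathfrak m}(R/fR)_{\le -pn(d-1)}$$ is injective. -/

import Mathlib

open scoped TensorProduct

universe u

/-! ### The Frobenius map and F-purity -/

/-- A ring homomorphism `φ : A → B` is pure if `M → B ⊗_A M`, `m ↦ 1 ⊗ m`, is injective for every
`A`-module `M`. -/
def RingHomIsPure {A B : Type u} [CommRing A] [CommRing B] (φ : A →+* B) : Prop :=
  letI : Algebra A B := φ.toAlgebra
  ∀ (M : Type u) [AddCommGroup M] [Module A M],
    Function.Injective (fun m : M => (1 : B) ⊗ₜ[A] m)

theorem add_pow_prime_of_algebra (k : Type*) [Field k] (p : ℕ) [Fact p.Prime] [CharP k p]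
    {A : Type*} [CommRing A] [Algebra k A] (a b : A) : (a + b) ^ p = a ^ p + b ^ p := by
  rcases subsingleton_or_nontrivial A with h | h
  · exact Subsingleton.elim _ _
  · have : CharP A p := charP_of_injective_algebraMap (algebraMap k A).injective p
    exact add_pow_char a b p

/-- The Frobenius map `a ↦ a ^ p` of an algebra over a field of characteristic `p`
(the zero ring is allowed). -/
def frobeniusOver (k : Type*) [Field k] (p : ℕ) [Fact p.Prime] [CharP k p]
    (A : Type*) [CommRing A] [Algebra k A] : A →+* A where
  toFun a := a ^ p
  map_one' := one_pow p
  map_mul' a b := mul_pow a b p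
  map_zero' := zero_pow (Fact.out : p.Prime).ne_zero
  map_add' a b := add_pow_prime_of_algebra k p a b

/-- `A` is F-pure if its Frobenius map is pure. -/
def IsFPure (k : Type u) [Field k] (p : ℕ) [Fact p.Prime] [CharP k p]
    (A : Type u) [CommRing A] [Algebra k A] : Prop :=
  RingHomIsPure (frobeniusOver k p A)

/-! ### Čech complexes and local cohomology -/

namespace Cech

section Complex

variable {A : Type*} [CommRing A] {m : ℕ} (x : Fin m → A)

/-- The localization `A_{x_I}`, where `x_I` is the product of the `x_j` with `j ∈ I`. -/
abbrev Loc (I : Finset (Fin m)) : Type _ := Localization.Away (∏ j ∈ I, x j)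

/-- The canonical map `A_{x_I} → A_{x_J}` for `I ⊆ J`. -/
noncomputable def res {I J : Finset (Fin m)} (h : I ⊆ J) : Loc x I →ₐ[A] Loc x J :=
  IsLocalization.liftAlgHom (M := Submonoid.powers (∏ j ∈ I, x j))
    (f := Algebra.ofId A (Loc x J)) (by
      rintro ⟨_, t, rfl⟩
      have h1 : IsUnit (algebraMap A (Loc x J) (∏ j ∈ J, x j)) :=
        IsLocalization.Away.algebraMap_isUnit _
      have h2 : IsUnit (algebraMap A (Loc x J) (∏ j ∈ I, x j)) :=
        isUnit_of_dvd_unit (map_dvd _ (Finset.prod_dvd_prod_of_subset I J x h)) h1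
      simpa [Algebra.ofId_apply] using h2.pow t)

/-- The Čech cochains of all degrees at once: the product of all `A_{x_I}`. The cochains of
degree `i` are those that are supported on the `I` with `i` elements. -/
abbrev Cochain : Type _ := ∀ I : Finset (Fin m), Loc x I

/-- The Čech differential:
`(d c)_J = ∑_{j ∈ J} (-1) ^ #{l ∈ J | l < j} • c_{J \ j}` (restricted to `A_{x_J}`). -/
noncomputable def d : Cochain x →ₗ[A] Cochain x where
  toFun c J := ∑ j ∈ J, (-1 : ℤ) ^ (J.filter (· < j)).card •
    res x (Finset.erase_subset j J) (c (J.erase j))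
  map_add' c c' := by
    funext J
    simp only [Pi.add_apply, map_add, smul_add, Finset.sum_add_distrib]
  map_smul' a c := by
    funext J
    simp only [Pi.smul_apply, map_smul, RingHom.id_apply, Finset.smul_sum]
    exact Finset.sum_congr rfl fun j _ => smul_comm _ _ _

/-- The cocycles of degree `i`. -/
noncomputable def cocycles (i : ℕ) : Submodule A (Cochain x) where
  carrier := {c | (∀ I, I.card ≠ i → c I = 0) ∧ d x c = 0}
  zero_mem' := ⟨fun _ _ => rfl, map_zero _⟩
  add_mem' {c c'} hc hc' :=
    ⟨fun I hI => by rw [Pi.add_apply, hc.1 I hI, hc'.1 I hI, add_zero],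
      by rw [map_add, hc.2, hc'.2, add_zero]⟩
  smul_mem' a c hc :=
    ⟨fun I hI => by rw [Pi.smul_apply, hc.1 I hI, smul_zero], by rw [map_smul, hc.2, smul_zero]⟩

/-- The coboundaries of degree `i`: the `d b` with `b` a cochain of degree `i - 1`
(so only `0` if `i = 0`). -/
noncomputable def coboundaries (i : ℕ) : Submodule A (Cochain x) where
  carrier := {c | ∃ b : Cochain x, (∀ I, I.card + 1 ≠ i → b I = 0) ∧ d x b = c}
  zero_mem' := ⟨0, fun _ _ => rfl, map_zero _⟩
  add_mem' := by
    rintro _ _ ⟨b, hb, rfl⟩ ⟨b', hb', rfl⟩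
    exact ⟨b + b', fun I hI => by rw [Pi.add_apply, hb I hI, hb' I hI, add_zero], map_add _ _ _⟩
  smul_mem' := by
    rintro a _ ⟨b, hb, rfl⟩
    exact ⟨a • b, fun I hI => by rw [Pi.smul_apply, hb I hI, smul_zero], map_smul _ _ _⟩

/-- The local cohomology module `H^i_{(x)}(A)`, as the cohomology of the Čech complex on `x`. -/
abbrev H (i : ℕ) : Type _ := cocycles x i ⧸ (coboundaries x i).comap (cocycles x i).subtype

end Complex

section Frobenius

variable (k : Type*) [Field k] (p : ℕ) [Fact p.Prime] [CharP k p]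
  {A : Type*} [CommRing A] [Algebra k A] {m : ℕ} (x : Fin m → A)

/-- Frobenius on Čech cochains: Frobenius of the ring `A_{x_I}` in each component. -/
noncomputable def frobCochain : Cochain x →ₛₗ[frobeniusOver k p A] Cochain x where
  toFun c I := frobeniusOver k p (Loc x I) (c I)
  map_add' c c' := by
    funext I
    exact map_add _ _ _
  map_smul' a c := by
    funext I
    exact smul_pow a (c I) p

theorem d_frobCochain (c : Cochain x) : d x (frobCochain k p x c) = frobCochain k p x (d x c) := by
  funext J
  change ∑ j ∈ J, (-1 : ℤ) ^ (J.filter (· < j)).card •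
      res x (Finset.erase_subset j J) ((c (J.erase j)) ^ p) =
    frobeniusOver k p (Loc x J) (∑ j ∈ J, (-1 : ℤ) ^ (J.filter (· < j)).card •
      res x (Finset.erase_subset j J) (c (J.erase j)))
  rw [map_sum]
  refine Finset.sum_congr rfl fun j _ => ?_
  rw [map_zsmul, map_pow]
  rfl

theorem frobCochain_eq_zero {c : Cochain x} {I : Finset (Fin m)} (h : c I = 0) :
    frobCochain k p x c I = 0 := by
  change frobeniusOver k p (Loc x I) (c I) = 0
  rw [h, map_zero]

/-- Frobenius on cocycles. -/
noncomputable def frobCocycles (i : ℕ) :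
    cocycles x i →ₛₗ[frobeniusOver k p A] cocycles x i :=
  (frobCochain k p x).restrict (p := cocycles x i) (q := cocycles x i) fun c hc =>
    ⟨fun I hI => frobCochain_eq_zero k p x (hc.1 I hI), by
      rw [d_frobCochain, hc.2, map_zero]⟩

/-- The Frobenius action on the local cohomology module `H^i_{(x)}(A)`. -/
noncomputable def frobH (i : ℕ) : H x i →ₛₗ[frobeniusOver k p A] H x i :=
  Submodule.mapQ _ _ (frobCocycles k p x i) (by
    rintro ⟨c, hc⟩ ⟨b, hb, hbc⟩
    refine ⟨frobCochain k p x b, fun I hI => frobCochain_eq_zero k p x (hb I hI), ?_⟩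
    rw [d_frobCochain, hbc]
    rfl)

end Frobenius

end Cech

/-! ### Hypersurfaces -/

namespace Hypersurface

open MvPolynomial

section Defs

variable {k : Type u} [Field k] {n : ℕ}

/-- The homogeneous maximal ideal `(x_0, …, x_n)` of `k[x_0, …, x_n]`. -/
noncomputable def maxIdeal (k : Type u) [Field k] (n : ℕ) : Ideal (MvPolynomial (Fin (n + 1)) k) :=
  Ideal.span (Set.range X)

/-- The ring `R/fR` with `R = k[x_0, …, x_n]`. -/
abbrev Quot (f : MvPolynomial (Fin (n + 1)) k) : Type u :=
  MvPolynomial (Fin (n + 1)) k ⧸ Ideal.span {f}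

instance isPrime_maxIdeal : (maxIdeal k n).IsPrime := by
  have h : maxIdeal k n = RingHom.ker (constantCoeff : MvPolynomial (Fin (n + 1)) k →+* k) := by
    ext g
    rw [maxIdeal, ← Set.image_univ, mem_ideal_span_X_image, RingHom.mem_ker, constantCoeff_eq]
    constructor
    · intro h
      by_contra h0
      obtain ⟨i, _, hi⟩ := h 0 (mem_support_iff.mpr h0)
      exact hi rfl
    · intro h s hs
      by_contra! hc
      have h0 : s = 0 := Finsupp.ext fun i => hc i (Set.mem_univ i)
      rw [h0] at hs
      exact mem_support_iff.mp hs h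
  rw [h]
  exact RingHom.ker_isPrime _

/-- The ring `(R/fR)_𝔭`, for `𝔭` a prime of `R` (it is the zero ring if `f ∉ 𝔭`). -/
abbrev LocAt (f : MvPolynomial (Fin (n + 1)) k) (P : Ideal (MvPolynomial (Fin (n + 1)) k))
    [P.IsPrime] : Type u :=
  Localization (Algebra.algebraMapSubmonoid (Quot f) P.primeCompl)

/-- `R/fR` has an isolated non-F-pure point at `𝔪`: `(R/fR)_𝔪` is not F-pure, but `(R/fR)_𝔭` is
F-pure for every prime `𝔭 ⊊ 𝔪`. -/
def HasIsolatedNonFPurePoint (p : ℕ) [Fact p.Prime] [CharP k p]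
    (f : MvPolynomial (Fin (n + 1)) k) : Prop :=
  ¬ IsFPure k p (LocAt f (maxIdeal k n)) ∧
    ∀ (P : Ideal (MvPolynomial (Fin (n + 1)) k)) [P.IsPrime], P < maxIdeal k n →
      IsFPure k p (LocAt f P)

variable (f : MvPolynomial (Fin (n + 1)) k)

/-- The images of the variables in `R/fR`. -/
noncomputable def var (j : Fin (n + 1)) : Quot f := Ideal.Quotient.mk (Ideal.span {f}) (X j)

/-- The part of degree `j` of `(R/fR)_{x_I}`: all fractions `g / x_I ^ t` with `g` a
homogeneous polynomial of degree `j + t * #I` (only `g = 0` if this integer is negative). -/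
noncomputable def locDeg (I : Finset (Fin (n + 1))) (j : ℤ) : Submodule k (Cech.Loc (var f) I) where
  carrier := {z | ∃ (t : ℕ) (g : MvPolynomial (Fin (n + 1)) k),
    IsWeightedHomogeneous (fun _ => (1 : ℤ)) g (j + t * I.card) ∧
    z * algebraMap (Quot f) (Cech.Loc (var f) I) (∏ l ∈ I, var f l) ^ t =
      algebraMap (Quot f) (Cech.Loc (var f) I) (Ideal.Quotient.mk (Ideal.span {f}) g)}
  zero_mem' := ⟨0, 0, isWeightedHomogeneous_zero _ _ _, by simp⟩
  add_mem' := by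
    rintro z z' ⟨t, g, hg, h⟩ ⟨t', g', hg', h'⟩
    have hX : ∀ s : ℕ, IsWeightedHomogeneous (fun _ => (1 : ℤ))
        ((∏ l ∈ I, (X l : MvPolynomial (Fin (n + 1)) k)) ^ s) (s * I.card) := fun s => by
      have h1 := (IsWeightedHomogeneous.prod (w := fun _ => (1 : ℤ)) I
        (fun l => (X l : MvPolynomial (Fin (n + 1)) k)) (fun _ => (1 : ℤ))
        (fun l _ => isWeightedHomogeneous_X k _ l)).pow s
      simpa using h1
    refine ⟨t + t', g * (∏ l ∈ I, X l) ^ t' + g' * (∏ l ∈ I, X l) ^ t, ?_, ?_⟩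
    · refine IsWeightedHomogeneous.add ?_ ?_
      · have := hg.mul (hX t')
        convert this using 1
        push_cast
        ring
      · have := hg'.mul (hX t)
        convert this using 1
        push_cast
        ring
    · have hv : Ideal.Quotient.mk (Ideal.span {f}) (∏ l ∈ I, X l) = ∏ l ∈ I, var f l :=
        map_prod _ _ _
      simp only [map_add, map_mul, map_pow, hv, ← h, ← h']
      ring
  smul_mem' := by
    rintro a z ⟨t, g, hg, h⟩
    refine ⟨t, a • g, ?_, ?_⟩
    · exact (weightedHomogeneousSubmodule k (fun _ => (1 : ℤ)) _).smul_mem a hg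
    · have h2 : Ideal.Quotient.mk (Ideal.span {f}) (a • g) =
          a • Ideal.Quotient.mk (Ideal.span {f}) g := rfl
      rw [smul_mul_assoc, h, h2]
      exact ((Algebra.linearMap (Quot f) (Cech.Loc (var f) I)).map_smul_of_tower a _).symm

/-- The Čech cochains of `R/fR` on `x_0, …, x_n` that are homogeneous of internal degree `j`. -/
noncomputable def cochainDeg (j : ℤ) : Submodule k (Cech.Cochain (var f)) :=
  Submodule.pi Set.univ fun I => locDeg f I j

/-- The local cohomology module `H^i_𝔪(R/fR)`. -/
abbrev H (i : ℕ) : Type u := Cech.H (var f) i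

/-- The part `H^i_𝔪(R/fR)_j` of degree `j`: the classes of the homogeneous cocycles of degree
`j`. -/
noncomputable def HDeg (i : ℕ) (j : ℤ) : Submodule k (H f i) :=
  ((cochainDeg f j).comap ((Cech.cocycles (var f) i).subtype.restrictScalars k)).map
    ((Submodule.mkQ ((Cech.coboundaries (var f) i).comap
      (Cech.cocycles (var f) i).subtype)).restrictScalars k)

/-- The part `H^i_𝔪(R/fR)_{≤ N}` of all degrees `j ≤ N`. -/
noncomputable def HLE (i : ℕ) (N : ℤ) : Submodule k (H f i) := ⨆ j : Set.Iic N, HDeg f i j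

variable (p : ℕ) [Fact p.Prime] [CharP k p]

theorem frobenius_mem_locDeg {I : Finset (Fin (n + 1))} {j : ℤ} {z : Cech.Loc (var f) I}
    (hz : z ∈ locDeg f I j) : frobeniusOver k p _ z ∈ locDeg f I (p * j) := by
  obtain ⟨t, g, hg, h⟩ := hz
  refine ⟨p * t, g ^ p, ?_, ?_⟩
  · have := hg.pow p
    convert this using 1
    simp only [nsmul_eq_mul]
    push_cast
    ring
  · change z ^ p * _ = _
    rw [map_pow, map_pow, ← h, mul_pow, ← pow_mul, mul_comm t p]

theorem frobH_mem_HDeg {i : ℕ} {j : ℤ} {z : H f i} (hz : z ∈ HDeg f i j) :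
    Cech.frobH k p (var f) i z ∈ HDeg f i (p * j) := by
  obtain ⟨c, hc, rfl⟩ := hz
  exact ⟨Cech.frobCocycles k p (var f) i c,
    fun I _ => frobenius_mem_locDeg f p (hc I (Set.mem_univ I)), rfl⟩

theorem frobH_mem_HLE {i : ℕ} {N : ℤ} {z : H f i} (hz : z ∈ HLE f i N) :
    Cech.frobH k p (var f) i z ∈ HLE f i (p * N) := by
  refine Submodule.iSup_induction _
    (motive := fun z => Cech.frobH k p (var f) i z ∈ HLE f i (p * N)) hz ?_ ?_ ?_
  · rintro ⟨j, hj⟩ y hy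
    have hj' : (p : ℤ) * j ≤ p * N := mul_le_mul_of_nonneg_left hj (Int.natCast_nonneg p)
    exact Submodule.mem_iSup_of_mem (p := fun j : Set.Iic ((p : ℤ) * N) => HDeg f i j)
      ⟨_, hj'⟩ (frobH_mem_HDeg f p hy)
  · rw [map_zero]
    exact Submodule.zero_mem _
  · intro _ _ hy hy'
    rw [map_add]
    exact Submodule.add_mem _ hy hy'

/-- The Frobenius action `F : H^i_𝔪(R/fR)_{≤ N} → H^i_𝔪(R/fR)_{≤ pN}`. -/
noncomputable def frobeniusLE (i : ℕ) (N : ℤ) : HLE f i N →+ HLE f i (p * N) where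
  toFun z := ⟨Cech.frobH k p (var f) i z, frobH_mem_HLE f p z.2⟩
  map_zero' := Subtype.ext (map_zero _)
  map_add' _ _ := Subtype.ext (map_add _ _ _)

end Defs

end Hypersurface

/-! Choose coordinates `φ i` of `R` over `R^p`, each lowering degrees by a factor `p`. By Fedder's
criterion `(R/fR)_𝔭` fails to be F-pure exactly when `𝔭` contains the ideal `J` generated by the
`φ i (f ^ (p - 1))`, which are forms of degree at most `d - 1`. Hence the non-F-pure point at `𝔪`
is isolated if and only if `J` is `𝔪`-primary. In that case `J` contains, over an algebraic closure
of `k`, an `𝔪`-primary ideal generated by `n + 1` forms of degree `d - 1`, and such an ideal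
contains every form of degree greater than `(n + 1)(d - 2)`.

Classes in `H^n(R/fR)` are numerators `h` over `(x_0 ⋯ x_n)^t` with `f h ∈ (x_0^t, …, x_n^t)`.
Such a class vanishes exactly when `h ∈ (x_0^t, …, x_n^t)`, and Frobenius sends it to the class of
`f^(p - 1) h^p` over `(x_0 ⋯ x_n)^(p t)`, so it is killed by Frobenius exactly when
`J h ⊆ (x_0^t, …, x_n^t)`. Modulo the `x_l^t` the polynomial ring is Gorenstein with socle
`(x_0 ⋯ x_n)^(t - 1)`; the resulting duality turns injectivity in degrees at most `-n(d - 1)` into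
`J` containing all monomials of degree greater than `(n + 1)(d - 2)`. -/

/-! ### Cartier-linear maps -/

/-- An additive map `φ` is `q⁻¹`-linear, or Cartier linear for the exponent `q`, if it takes
`q`-th powers out as scalars. -/
def IsCartierLinear (q : ℕ) {A : Type*} [CommRing A] (φ : A →+ A) : Prop :=
  ∀ r g, φ (r ^ q * g) = r * φ g

/-- The maps `φ i` are `p⁻¹`-linear coordinate functions for the generators `e i` of `A` as a module
over its `p`-th powers; the `e i` need not be a basis. -/
structure IsCartierCoordinates (p : ℕ) {A ι : Type*} [CommRing A] [Fintype ι]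
    (φ : ι → A →+ A) (e : ι → A) : Prop where
  isCartierLinear (i : ι) : IsCartierLinear p (φ i)
  sum_pow_mul (g : A) : ∑ i, φ i g ^ p * e i = g

/-- The ideal `I₁(g)` of Fedder's criterion, generated by the Cartier coordinates of `g`. -/
def cartierIdeal {A ι : Type*} [CommRing A] (φ : ι → A →+ A) (g : A) : Ideal A :=
  Ideal.span (Set.range fun i => φ i g)

namespace IsCartierLinear

variable {q : ℕ} {A : Type*} [CommRing A] {φ : A →+ A}

theorem mul_left (hφ : IsCartierLinear q φ) (c : A) :
    IsCartierLinear q (φ.comp (AddMonoidHom.mulLeft c)) := fun r g => by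
  simp only [AddMonoidHom.comp_apply, AddMonoidHom.coe_mulLeft]
  rw [mul_left_comm, hφ]

theorem apply_mem_of_mem_span_pow (hφ : IsCartierLinear q φ) {ι : Type*} [Finite ι] {F : ι → A}
    {g : A} (hg : g ∈ Ideal.span (Set.range fun i => F i ^ q)) :
    φ g ∈ Ideal.span (Set.range F) := by
  have := Fintype.ofFinite ι
  obtain ⟨c, rfl⟩ := Ideal.mem_span_range_iff_exists_fun.mp hg
  rw [map_sum]
  refine Ideal.sum_mem _ fun i _ => ?_
  rw [mul_comm, hφ]
  exact Ideal.mul_mem_right _ _ (Ideal.subset_span ⟨i, rfl⟩)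

variable {k : Type*} [Field k] {p : ℕ} [Fact p.Prime] [CharP k p] [Algebra k A]

theorem apply_mem (hφ : IsCartierLinear p φ) {I : Ideal A} {g : A}
    (hg : g ∈ I.map (frobeniusOver k p A)) : φ g ∈ I := by
  induction hg using Submodule.closure_induction with
  | zero => simp
  | add g g' _ _ h h' => rw [map_add]; exact add_mem h h'
  | smul_mem c g hg =>
    obtain ⟨r, hr, rfl⟩ := hg
    rw [smul_eq_mul, mul_comm]
    exact (hφ r c).symm ▸ I.mul_mem_right _ hr

end IsCartierLinear

namespace IsCartierCoordinates

variable {p : ℕ} {A ι : Type*} [CommRing A] [Fintype ι] {φ : ι → A →+ A} {e : ι → A}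
  (k : Type*) [Field k] [Fact p.Prime] [CharP k p] [Algebra k A]

theorem cartierIdeal_le_iff (hφ : IsCartierCoordinates p φ e) {g : A} {I : Ideal A} :
    cartierIdeal φ g ≤ I ↔ g ∈ I.map (frobeniusOver k p A) := by
  rw [cartierIdeal, Ideal.span_le, Set.range_subset_iff]
  refine ⟨fun h => ?_, fun h i => (hφ.isCartierLinear i).apply_mem h⟩
  rw [← hφ.sum_pow_mul g]
  exact sum_mem fun i _ => Ideal.mul_mem_right _ _ (Ideal.mem_map_of_mem _ (h i))

include k in
theorem cartierIdeal_one (hφ : IsCartierCoordinates p φ e) : cartierIdeal φ 1 = ⊤ := by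
  by_contra h
  obtain ⟨M, hM, hle⟩ := Ideal.exists_le_maximal _ h
  have hMp : M.map (frobeniusOver k p A) ≤ M :=
    Ideal.map_le_iff_le_comap.mpr fun r hr => M.pow_mem_of_mem hr p (Fact.out : p.Prime).pos
  exact hM.ne_top ((Ideal.eq_top_iff_one M).mpr (hMp ((hφ.cartierIdeal_le_iff k).mp hle)))

theorem pow_mem_map_frobeniusOver_iff (hφ : IsCartierCoordinates p φ e) {v : A} {I : Ideal A} :
    v ^ p ∈ I.map (frobeniusOver k p A) ↔ v ∈ I := by
  refine ⟨fun h => ?_, fun h => Ideal.mem_map_of_mem (frobeniusOver k p A) h⟩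
  have hv : cartierIdeal φ 1 ≤ I.colon {v} := by
    rw [cartierIdeal, Ideal.span_le, Set.range_subset_iff]
    intro i
    have h2 := (hφ.isCartierLinear i).apply_mem h
    rw [← mul_one (v ^ p), hφ.isCartierLinear i] at h2
    rwa [SetLike.mem_coe, Submodule.mem_colon_singleton, smul_eq_mul, mul_comm]
  rw [hφ.cartierIdeal_one k, top_le_iff, Ideal.eq_top_iff_one, Submodule.mem_colon_singleton,
    one_smul] at hv
  exact hv

include k in
theorem mem_cartierIdeal_pow_sub_one (hφ : IsCartierCoordinates p φ e) (f : A) :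
    f ∈ cartierIdeal φ (f ^ (p - 1)) := by
  rw [← hφ.pow_mem_map_frobeniusOver_iff k, ← mul_pow_sub_one (Fact.out : p.Prime).ne_zero f]
  exact Ideal.mul_mem_left _ _ ((hφ.cartierIdeal_le_iff k).mp le_rfl)

end IsCartierCoordinates

section MvPolynomial

open MvPolynomial

variable {σ k : Type*} [Field k] {q : ℕ} [NeZero q]

theorem smul_add_injective (α : σ →₀ ℕ) : Function.Injective fun γ : σ →₀ ℕ => q • γ + α :=
  (add_left_injective α).comp fun γ γ' h => by
    ext i
    exact Nat.eq_of_mul_eq_mul_left (NeZero.pos q) (DFunLike.congr_fun h i)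

/-- The Cartier operator attached to an additive map `π` of the coefficients and an exponent `α`:
it keeps the monomials `x ^ (q γ + α)` and takes them to `x ^ γ`. -/
noncomputable def cartier (q : ℕ) [NeZero q] (π : k →+ k) (α : σ →₀ ℕ) :
    MvPolynomial σ k →+ MvPolynomial σ k where
  toFun g := AddMonoidAlgebra.map π
    (AddMonoidAlgebra.comapDomain (fun γ : σ →₀ ℕ => q • γ + α) (smul_add_injective α) g)
  map_zero' := by ext; simp [coeff]
  map_add' a b := by
    ext γ
    simp [coeff]

@[simp] theorem coeff_cartier (π : k →+ k) (α : σ →₀ ℕ) (g : MvPolynomial σ k) (γ : σ →₀ ℕ) :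
    coeff γ (cartier q π α g) = π (coeff (q • γ + α) g) := by
  simp [cartier, coeff]

theorem cartier_monomial_smul_add (π : k →+ k) (α γ : σ →₀ ℕ) (c : k) :
    cartier q π α (monomial (q • γ + α) c) = monomial γ (π c) := by
  classical
  ext δ
  simp only [coeff_cartier, coeff_monomial, (smul_add_injective (q := q) α).eq_iff]
  split_ifs <;> simp

theorem cartier_monomial_eq_zero (π : k →+ k) {α b : σ →₀ ℕ} (h : ∀ γ : σ →₀ ℕ, q • γ + α ≠ b)
    (c : k) : cartier q π α (monomial b c) = 0 := by
  classical
  ext δ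
  rw [coeff_cartier, coeff_monomial, if_neg (h δ).symm, map_zero, coeff_zero]

omit [NeZero q] in
theorem le_of_smul_le_smul_add {α a δ : σ →₀ ℕ} (hα : ∀ i, α i < q) (h : q • a ≤ q • δ + α) :
    a ≤ δ := fun i => by
  have h1 : q * a i ≤ q * δ i + α i := h i
  have h2 : q * a i < q * (δ i + 1) := by linarith [hα i]
  exact Nat.lt_succ_iff.mp (lt_of_mul_lt_mul_left' h2)

theorem isCartierLinear_cartier {p e : ℕ} [Fact p.Prime] [CharP k p] (hq : q = p ^ e)
    {π : k →+ k} (hπ : IsCartierLinear q π) {α : σ →₀ ℕ} (hα : ∀ i, α i < q) :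
    IsCartierLinear q (cartier q π α) := by
  classical
  intro r g
  induction r using MvPolynomial.induction_on' with
  | add r s hr hs =>
    have hadd : (r + s) ^ q = r ^ q + s ^ q := by rw [hq, add_pow_char_pow]
    rw [hadd, add_mul, map_add, hr, hs, add_mul]
  | monomial a c =>
    ext δ
    rw [monomial_pow, coeff_cartier, coeff_monomial_mul', coeff_monomial_mul', coeff_cartier]
    by_cases h : a ≤ δ
    · have h1 : q • a ≤ q • δ := nsmul_le_nsmul_right h _
      have h2 : q • δ + α - q • a = q • (δ - a) + α := by
        ext i
        simp only [Finsupp.tsub_apply, Finsupp.add_apply, Finsupp.smul_apply, smul_eq_mul,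
          Nat.mul_sub]
        exact Nat.sub_add_comm (h1 i)
      rw [if_pos h, if_pos (h1.trans le_self_add), hπ, h2]
    · rw [if_neg h, if_neg (mt (le_of_smul_le_smul_add hα) h), map_zero]

theorem degree_eq_of_coeff_cartier_ne_zero {π : k →+ k} {α γ : σ →₀ ℕ} {g : MvPolynomial σ k}
    {D : ℕ} (hg : g.IsHomogeneous D) (hγ : coeff γ (cartier q π α g) ≠ 0) :
    q * γ.degree + α.degree = D := by
  by_contra h
  refine hγ ?_
  rw [coeff_cartier, hg.coeff_eq_zero (by simpa using h), map_zero]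

theorem exists_isHomogeneous_cartier (π : k →+ k) (α : σ →₀ ℕ) {g : MvPolynomial σ k} {D : ℕ}
    (hg : g.IsHomogeneous D) : ∃ m, q * m ≤ D ∧ (cartier q π α g).IsHomogeneous m := by
  by_cases h : cartier q π α g = 0
  · exact ⟨0, Nat.zero_le _, h ▸ isHomogeneous_zero _ _ _⟩
  obtain ⟨γ, hγ⟩ := ne_zero_iff.mp h
  have h1 := degree_eq_of_coeff_cartier_ne_zero hg hγ
  refine ⟨γ.degree, h1 ▸ Nat.le_add_right _ _, fun δ hδ => ?_⟩
  have h2 := degree_eq_of_coeff_cartier_ne_zero hg hδ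
  change Finsupp.weight (fun _ => 1) δ = _
  rw [← Finsupp.degree_eq_weight_one]
  exact Nat.eq_of_mul_eq_mul_left (NeZero.pos q) (by omega)

theorem exists_coordinates_of_finite {K B : Type*} [Field K] [CommRing B] {F : K →+* B}
    (hF : F.Finite) : ∃ (N : ℕ) (π : Fin N → B →+ K) (u : Fin N → B),
      (∀ i r g, π i (F r * g) = r * π i g) ∧ ∀ c, ∑ i, F (π i c) * u i = c := by
  algebraize [F]
  let b := Module.finBasis K B
  exact ⟨_, fun i => (b.coord i).toAddMonoidHom, b, fun i r g => (b.coord i).map_smul r g,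
    b.sum_repr⟩

theorem exists_isCartierCoordinates_field {p : ℕ} [Fact p.Prime] [CharP k p]
    (hk : (frobenius k p).Finite) :
    ∃ (N : ℕ) (π : Fin N → k →+ k) (u : Fin N → k), IsCartierCoordinates p π u :=
  let ⟨N, π, u, hπ, hu⟩ := exists_coordinates_of_finite hk
  ⟨N, π, u, hπ, hu⟩

/-- The exponent vector with the given entries below `q`. -/
noncomputable def digitExponent [Finite σ] (a : σ → Fin q) : σ →₀ ℕ :=
  Finsupp.equivFunOnFinite.symm fun i => (a i : ℕ)

theorem exists_smul_add_digitExponent [Finite σ] (b : σ →₀ ℕ) :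
    ∃ (γ : σ →₀ ℕ) (a : σ → Fin q), q • γ + digitExponent a = b :=
  ⟨Finsupp.equivFunOnFinite.symm fun i => b i / q, fun i => Fin.ofNat q (b i), by
    ext i
    simp [digitExponent, Nat.div_add_mod]⟩

omit [NeZero q] in
theorem digitExponent_eq_of_smul_add_eq [Finite σ] {γ γ' : σ →₀ ℕ} {a a' : σ → Fin q}
    (h : q • γ + digitExponent a = q • γ' + digitExponent a') : a = a' := by
  ext i
  have hi : q * γ i + a i = q * γ' i + a' i := DFunLike.congr_fun h i
  simpa [Nat.mul_add_mod, Nat.mod_eq_of_lt] using congrArg (· % q) hi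

theorem sum_cartier_monomial_pow_mul [Finite σ] [Fintype (σ → Fin q)] {ι : Type*} [Fintype ι]
    {π : ι → k →+ k} {u : ι → k} (hπ : IsCartierCoordinates q π u) (b : σ →₀ ℕ) (c : k) :
    ∑ i : (σ → Fin q) × ι, cartier q (π i.2) (digitExponent i.1) (monomial b c) ^ q *
      monomial (digitExponent i.1) (u i.2) = monomial b c := by
  obtain ⟨γ, a, rfl⟩ := exists_smul_add_digitExponent (q := q) b
  rw [Fintype.sum_prod_type, Finset.sum_eq_single_of_mem a (Finset.mem_univ a)]
  · simp only [cartier_monomial_smul_add, monomial_pow, monomial_mul]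
    rw [← map_sum, hπ.sum_pow_mul]
  · intro a' _ ha'
    refine Finset.sum_eq_zero fun i _ => ?_
    rw [cartier_monomial_eq_zero _ fun γ' h => ha' (digitExponent_eq_of_smul_add_eq h),
      zero_pow (NeZero.ne q), zero_mul]

theorem isCartierCoordinates_cartier [Finite σ] {p : ℕ} [Fact p.Prime] [CharP k p]
    [Fintype (σ → Fin p)] {ι : Type*} [Fintype ι] {π : ι → k →+ k} {u : ι → k}
    (hπ : IsCartierCoordinates p π u) :
    IsCartierCoordinates p
      (fun i : (σ → Fin p) × ι => cartier p (π i.2) (digitExponent i.1))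
      fun i => monomial (digitExponent i.1) (u i.2) where
  isCartierLinear i :=
    isCartierLinear_cartier (pow_one p).symm (hπ.isCartierLinear i.2) fun j => (i.1 j).2
  sum_pow_mul g := by
    induction g using MvPolynomial.induction_on' with
    | monomial b c => exact sum_cartier_monomial_pow_mul hπ b c
    | add r s hr hs =>
      simp only [map_add, add_pow_char, add_mul, Finset.sum_add_distrib, hr, hs]

theorem exists_isCartierCoordinates {σ : Type u} [Finite σ] {p : ℕ} [Fact p.Prime] [CharP k p]
    (hk : (frobenius k p).Finite) :
    ∃ (ι : Type u) (_ : Fintype ι) (φ : ι → MvPolynomial σ k →+ MvPolynomial σ k)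
      (e : ι → MvPolynomial σ k), IsCartierCoordinates p φ e ∧
      ∀ i g D, g.IsHomogeneous D → ∃ m, p * m ≤ D ∧ (φ i g).IsHomogeneous m := by
  have := Fintype.ofFinite (σ → Fin p)
  obtain ⟨N, π, u, hπ⟩ := exists_isCartierCoordinates_field hk
  exact ⟨(σ → Fin p) × Fin N, inferInstance, _, _, isCartierCoordinates_cartier hπ,
    fun _ _ _ => exists_isHomogeneous_cartier _ _⟩

end MvPolynomial

/-! ### Fedder's criterion -/

theorem RingHomIsPure.of_retraction {A B : Type u} [CommRing A] [CommRing B] {F : A →+* B}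
    (ψ : B →+ A) (hψ : ∀ a b, ψ (F a * b) = a * ψ b) (h1 : ψ 1 = 1) : RingHomIsPure F := by
  let : Algebra A B := F.toAlgebra
  intro M _ _ m m' (hm : (1 : B) ⊗ₜ[A] m = (1 : B) ⊗ₜ[A] m')
  let ψA : B →ₗ[A] A := { ψ with map_smul' := hψ }
  have h := congrArg ((TensorProduct.lid A M) ∘ ψA.rTensor M) hm
  simpa [ψA, h1] using h

theorem RingHomIsPure.mem_of_map_mem {A B : Type u} [CommRing A] [CommRing B] {F : A →+* B}
    (h : RingHomIsPure F) {I : Ideal A} {v : A} (hv : F v ∈ I.map F) : v ∈ I := by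
  let : Algebra A B := F.toAlgebra
  rw [← Ideal.Quotient.eq_zero_iff_mem]
  refine h (A ⧸ I) ((TensorProduct.tensorQuotEquivQuotSMul B I).injective ?_)
  change TensorProduct.tensorQuotEquivQuotSMul B I (1 ⊗ₜ Ideal.Quotient.mk I v) =
    TensorProduct.tensorQuotEquivQuotSMul B I (1 ⊗ₜ 0)
  rw [TensorProduct.tensorQuotEquivQuotSMul_tmul_mk, TensorProduct.tmul_zero, map_zero,
    Submodule.Quotient.mk_eq_zero, Ideal.smul_top_eq_map, Algebra.smul_def, mul_one]
  exact hv

theorem IsFPure.of_isCartierLinear {k : Type u} [Field k] {p : ℕ} [Fact p.Prime] [CharP k p]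
    {B : Type u} [CommRing B] [Algebra k B] {ψ : B →+ B} (hψ : IsCartierLinear p ψ)
    (h1 : IsUnit (ψ 1)) : IsFPure k p B := by
  obtain ⟨w, hw⟩ := h1
  refine RingHomIsPure.of_retraction (ψ.comp (AddMonoidHom.mulLeft ((↑w⁻¹ : B) ^ p)))
    (hψ.mul_left _) ?_
  rw [AddMonoidHom.comp_apply, AddMonoidHom.coe_mulLeft, hψ, ← hw, Units.inv_mul]

theorem IsCartierLinear.exists_of_surjective {q : ℕ} {A B : Type*} [CommRing A] [CommRing B]
    {φ : A →+ A} (hφ : IsCartierLinear q φ) {ρ : A →+* B} (hρ : Function.Surjective ρ)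
    (hker : ∀ a ∈ RingHom.ker ρ, φ a ∈ RingHom.ker ρ) :
    ∃ ψ : B →+ B, IsCartierLinear q ψ ∧ ∀ a, ψ (ρ a) = ρ (φ a) := by
  let ψ := ρ.toAddMonoidHom.liftOfSurjective hρ ⟨ρ.toAddMonoidHom.comp φ, hker⟩
  have hψ (a : A) : ψ (ρ a) = ρ (φ a) :=
    ρ.toAddMonoidHom.liftOfRightInverse_comp_apply _ _ ⟨ρ.toAddMonoidHom.comp φ, hker⟩ a
  refine ⟨ψ, fun r z => ?_, hψ⟩
  obtain ⟨r, rfl⟩ := hρ r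
  obtain ⟨a, rfl⟩ := hρ z
  rw [← map_pow, ← map_mul, hψ, hψ, hφ, map_mul]

section Local

open IsLocalRing

variable {k : Type u} [Field k] {p : ℕ} [Fact p.Prime] [CharP k p]

section Splitting

variable {A : Type*} {B : Type u} [CommRing A] [CommRing B] [Algebra k B] {ρ : A →+* B}
  {φ : A →+ A}

theorem IsFPure.of_surjective (hφ : IsCartierLinear p φ) (hρ : Function.Surjective ρ)
    (hker : ∀ a ∈ RingHom.ker ρ, φ a ∈ RingHom.ker ρ) (h1 : IsUnit (φ 1)) : IsFPure k p B := by
  obtain ⟨ψ, hψ, hψρ⟩ := hφ.exists_of_surjective hρ hker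
  refine IsFPure.of_isCartierLinear hψ ?_
  rw [← map_one ρ, hψρ]
  exact h1.map ρ

theorem IsFPure.of_ker_eq_span_singleton (hφ : IsCartierLinear p φ)
    (hρ : Function.Surjective ρ) {f : A} (hker : RingHom.ker ρ = Ideal.span {f})
    (h : IsUnit (φ (f ^ (p - 1)))) : IsFPure k p B := by
  refine IsFPure.of_surjective (hφ.mul_left (f ^ (p - 1))) hρ (fun a ha => ?_) (by simpa using h)
  rw [hker, Ideal.mem_span_singleton] at ha ⊢
  obtain ⟨b, rfl⟩ := ha
  rw [AddMonoidHom.comp_apply, AddMonoidHom.coe_mulLeft, ← mul_assoc,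
    pow_sub_one_mul (Fact.out : p.Prime).ne_zero, hφ]
  exact dvd_mul_right _ _

end Splitting

theorem exists_socle_or_exists_regular {A : Type*} [CommRing A] [IsNoetherianRing A]
    (P K : Ideal A) :
    (∃ v ∉ K, ∀ y ∈ P, y * v ∈ K) ∨ ∃ y ∈ P, ∀ a, y * a ∈ K → a ∈ K := by
  have hfin := associatedPrimes.finite A (A ⧸ K)
  by_cases h : (P : Set A) ⊆ ⋃ Q ∈ (hfin.toFinset : Set (Ideal A)), Q
  · obtain ⟨Q, hQ, hPQ⟩ := (Ideal.subset_union_prime (f := id) ⊤ ⊤ fun Q hQ _ _ =>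
      (hfin.mem_toFinset.mp hQ).isPrime).mp h
    obtain ⟨hQprime, x, hx⟩ := isAssociatedPrime_iff.mp (hfin.mem_toFinset.mp hQ)
    obtain ⟨v, rfl⟩ := Ideal.Quotient.mk_surjective x
    have hmem (r : A) : r ∈ Q ↔ r * v ∈ K := by
      rw [hx, Submodule.mem_colon_singleton, Submodule.mem_bot, Algebra.smul_def,
        Ideal.Quotient.algebraMap_eq, ← map_mul, Ideal.Quotient.eq_zero_iff_mem]
    refine .inl ⟨v, fun hv => hQprime.one_notMem ((hmem 1).mpr ?_), fun y hy =>
      (hmem y).mp (hPQ hy)⟩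
    rwa [one_mul]
  · obtain ⟨y, hy, hyQ⟩ := Set.not_subset.mp h
    refine .inr ⟨y, hy, fun a ha => ?_⟩
    by_contra haK
    rw [Set.Finite.coe_toFinset, biUnion_associatedPrimes_eq_zero_divisors] at hyQ
    refine hyQ ⟨Ideal.Quotient.mk K a, mt Ideal.Quotient.eq_zero_iff_mem.mp haK, ?_⟩
    rw [Algebra.smul_def]
    exact Ideal.Quotient.eq_zero_iff_mem.mpr ha

theorem mem_of_mul_mem_span_singleton_sup {A : Type*} [CommRing A] {I : Ideal A} {f y : A}
    (hf : ∀ a, f * a ∈ I → a ∈ I)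
    (hy : ∀ a, y * a ∈ Ideal.span {f} ⊔ I → a ∈ Ideal.span {f} ⊔ I) {a : A}
    (ha : f * a ∈ Ideal.span {y} ⊔ I) : a ∈ Ideal.span {y} ⊔ I := by
  simp only [Ideal.mem_span_singleton_sup] at hy ha ⊢
  obtain ⟨b, i, hi, hbi⟩ := ha
  obtain ⟨b', i', hi', rfl⟩ := hy b ⟨a, -i, neg_mem hi, by linear_combination -hbi⟩
  refine ⟨b', a - b' * y, hf _ ?_, by ring⟩
  have h : f * (a - b' * y) = y * i' + i := by linear_combination -hbi
  exact h ▸ add_mem (I.mul_mem_left _ hi') hi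

theorem exists_regular_ideal_socle {A : Type*} [CommRing A] [IsLocalRing A] [IsNoetherianRing A]
    {f : A} (hf : f ∈ nonZeroDivisors A) (hfm : f ∈ maximalIdeal A) :
    ∃ I : Ideal A, (∀ a, f * a ∈ I → a ∈ I) ∧
      ∃ v ∉ Ideal.span {f} ⊔ I, ∀ y ∈ maximalIdeal A, y * v ∈ Ideal.span {f} ⊔ I := by
  obtain ⟨I, ⟨hIm, hI⟩, hmax⟩ := (wellFounded_gt (α := Ideal A)).has_min
    {I | I ≤ maximalIdeal A ∧ ∀ a, f * a ∈ I → a ∈ I}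
    ⟨⊥, bot_le, fun a ha => by simpa [mul_left_mem_nonZeroDivisors_eq_zero_iff hf] using ha⟩
  refine ⟨I, hI, (exists_socle_or_exists_regular (maximalIdeal A) _).resolve_right ?_⟩
  rintro ⟨y, hym, hy⟩
  have hspan {x : A} (hx : x ∈ maximalIdeal A) : Ideal.span {x} ⊔ I ≤ maximalIdeal A :=
    sup_le ((Ideal.span_singleton_le_iff_mem _).mpr hx) hIm
  refine hmax (Ideal.span {y} ⊔ I) ⟨hspan hym, fun _ => mem_of_mul_mem_span_singleton_sup hI hy⟩
    (lt_of_le_of_ne le_sup_right fun h => ?_)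
  have hyI : y ∈ I := h ▸ Ideal.mem_sup_left (Ideal.mem_span_singleton_self y)
  refine (maximalIdeal.isMaximal A).ne_top ((Ideal.eq_top_iff_one _).mpr (hspan hfm (hy 1 ?_)))
  rw [mul_one]
  exact Ideal.mem_sup_right hyI

variable {A ι : Type*} [CommRing A] [Algebra k A] [Fintype ι] {φ : ι → A →+ A} {e : ι → A}

theorem IsCartierCoordinates.mem_map_frobeniusOver_of_pow_sub_one_mul_mem
    (hφ : IsCartierCoordinates p φ e) {I : Ideal A} {f u : A} (hf : ∀ a, f * a ∈ I → a ∈ I)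
    (h : f ^ (p - 1) * u ∈ I.map (frobeniusOver k p A)) : u ∈ I.map (frobeniusOver k p A) := by
  have h1 : f ^ p * u ∈ I.map (frobeniusOver k p A) := by
    rw [← mul_pow_sub_one (Fact.out : p.Prime).ne_zero, mul_assoc]
    exact Ideal.mul_mem_left _ _ h
  rw [← hφ.cartierIdeal_le_iff k, cartierIdeal, Ideal.span_le, Set.range_subset_iff]
  intro i
  exact hf _ (hφ.isCartierLinear i f u ▸ (hφ.isCartierLinear i).apply_mem h1)

theorem IsCartierCoordinates.exists_pow_sub_mul_mem (hφ : IsCartierCoordinates p φ e)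
    {I : Ideal A} {f v : A} (hf : ∀ a, f * a ∈ I → a ∈ I)
    (hv : ∀ i, φ i (f ^ (p - 1)) * v ∈ Ideal.span {f} ⊔ I) :
    ∃ c, v ^ p - f * c ∈ I.map (frobeniusOver k p A) := by
  have h : v ^ p * f ^ (p - 1) ∈ (Ideal.span {f} ⊔ I).map (frobeniusOver k p A) := by
    rw [← hφ.cartierIdeal_le_iff k, cartierIdeal, Ideal.span_le, Set.range_subset_iff]
    intro i
    rw [hφ.isCartierLinear, mul_comm]
    exact hv i
  rw [Ideal.map_sup, Ideal.map_span, Set.image_singleton, Ideal.mem_span_singleton_sup] at h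
  obtain ⟨c, x, hx, hcx⟩ := h
  refine ⟨c, hφ.mem_map_frobeniusOver_of_pow_sub_one_mul_mem hf ?_⟩
  have hff : frobeniusOver k p A f = f * f ^ (p - 1) :=
    (mul_pow_sub_one (Fact.out : p.Prime).ne_zero f).symm
  rw [hff] at hcx
  have hx' : f ^ (p - 1) * (v ^ p - f * c) = x := by linear_combination -hcx
  exact hx' ▸ hx

variable {B : Type u} [CommRing B] [Algebra k B] {ρ : A →+* B}

theorem IsCartierCoordinates.not_isFPure [IsLocalRing A] [IsNoetherianRing A]
    (hφ : IsCartierCoordinates p φ e) (hρ : Function.Surjective ρ) {f : A}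
    (hf : f ∈ nonZeroDivisors A) (hker : RingHom.ker ρ = Ideal.span {f})
    (hle : cartierIdeal φ (f ^ (p - 1)) ≤ maximalIdeal A) : ¬ IsFPure k p B := by
  intro hpure
  obtain ⟨I, hI, v, hv, hmv⟩ :=
    exists_regular_ideal_socle hf (hle (hφ.mem_cartierIdeal_pow_sub_one k f))
  obtain ⟨c, hc⟩ := hφ.exists_pow_sub_mul_mem (k := k) hI
    fun i => hmv _ (hle (Ideal.subset_span ⟨i, rfl⟩))
  have hcomp : (frobeniusOver k p B).comp ρ = ρ.comp (frobeniusOver k p A) :=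
    RingHom.ext fun a => (map_pow ρ a p).symm
  have hfρ : ρ f = 0 := RingHom.mem_ker.mp (hker ▸ Ideal.mem_span_singleton_self f)
  have hvρ : ρ v ^ p ∈ (I.map ρ).map (frobeniusOver k p B) := by
    rw [Ideal.map_map, hcomp, ← Ideal.map_map]
    simpa [hfρ] using Ideal.mem_map_of_mem ρ hc
  refine hv ?_
  rw [← hker, sup_comm, ← Ideal.comap_map_of_surjective' ρ hρ]
  exact hpure.mem_of_map_mem hvρ

theorem IsCartierCoordinates.isFPure_iff [IsLocalRing A] [IsNoetherianRing A]
    (hφ : IsCartierCoordinates p φ e) (hρ : Function.Surjective ρ) {f : A}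
    (hf : f ∈ nonZeroDivisors A) (hker : RingHom.ker ρ = Ideal.span {f}) :
    IsFPure k p B ↔ ¬ cartierIdeal φ (f ^ (p - 1)) ≤ maximalIdeal A := by
  refine ⟨fun h hle => hφ.not_isFPure hρ hf hker hle h, fun h => ?_⟩
  rw [cartierIdeal, Ideal.span_le, Set.range_subset_iff, not_forall] at h
  obtain ⟨i, hi⟩ := h
  exact .of_ker_eq_span_singleton (hφ.isCartierLinear i) hρ hker (notMem_maximalIdeal.mp hi)

include k in
theorem IsCartierCoordinates.exists_isUnit_one [IsLocalRing A] (hφ : IsCartierCoordinates p φ e) :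
    ∃ i, IsUnit (φ i 1) := by
  by_contra! h
  refine (maximalIdeal.isMaximal A).ne_top (top_le_iff.mp ?_)
  rw [← hφ.cartierIdeal_one k, cartierIdeal, Ideal.span_le, Set.range_subset_iff]
  exact fun i => (mem_maximalIdeal _).mpr (h i)

end Local

section Localization

variable {p : ℕ} {A A' : Type*} [CommRing A] [CommRing A'] [Algebra A A'] (S : Submonoid A)
  [IsLocalization S A']

theorem exists_mul_algebraMap_pow_eq (hp : p ≠ 0) (z : A') :
    ∃ s ∈ S, ∃ a, z * algebraMap A A' s ^ p = algebraMap A A' a := by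
  obtain ⟨⟨a, s⟩, h⟩ := IsLocalization.surj S z
  refine ⟨s, s.2, a * s ^ (p - 1), ?_⟩
  rw [← mul_pow_sub_one hp, ← mul_assoc, h, map_mul, map_pow]

include S in
theorem IsCartierLinear.algebraMap_apply_eq_zero (hp : p ≠ 0) {φ : A →+ A}
    (hφ : IsCartierLinear p φ) {a : A} (ha : algebraMap A A' a = 0) :
    algebraMap A A' (φ a) = 0 := by
  rw [IsLocalization.map_eq_zero_iff S] at ha ⊢
  obtain ⟨c, hc⟩ := ha
  refine ⟨c, ?_⟩
  rw [← hφ, ← mul_pow_sub_one hp, mul_right_comm, hc, zero_mul, map_zero]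

include S in
theorem IsCartierLinear.exists_isLocalization (hp : p ≠ 0) {φ : A →+ A}
    (hφ : IsCartierLinear p φ) :
    ∃ φ' : A' →+ A', IsCartierLinear p φ' ∧
      ∀ a, φ' (algebraMap A A' a) = algebraMap A A' (φ a) := by
  have hunit {s : A} (hs : s ∈ S) : IsUnit (algebraMap A A' s) :=
    IsLocalization.map_units A' (⟨s, hs⟩ : S)
  choose den hden num hnum using exists_mul_algebraMap_pow_eq (A' := A') S hp
  choose ψ hψ using fun z : A' =>
    (hunit (hden z)).dvd (a := algebraMap A A' (φ (num z)))
  have hψ_mul {z : A'} {s a : A} (h : z * algebraMap A A' s ^ p = algebraMap A A' a) :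
      algebraMap A A' s * ψ z = algebraMap A A' (φ a) := by
    have h0 : algebraMap A A' (s ^ p * num z - den z ^ p * a) = 0 := by
      simp only [map_sub, map_mul, map_pow, ← hnum, ← h]
      ring
    have h1 := hφ.algebraMap_apply_eq_zero S hp h0
    rw [map_sub, hφ, hφ, map_sub, map_mul, map_mul, hψ] at h1
    refine (hunit (hden z)).mul_left_cancel ?_
    linear_combination h1
  refine ⟨AddMonoidHom.mk' ψ fun z z' => ?_, fun r z => ?_, fun a => ?_⟩
  · have h := hψ_mul (z := z + z') (s := den z * den z')
      (a := den z' ^ p * num z + den z ^ p * num z') (by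
        simp only [map_add, map_mul, map_pow, ← hnum]
        ring)
    refine ((hunit (hden z)).mul (hunit (hden z'))).mul_left_cancel ?_
    rw [← map_mul, h, map_add, hφ, hφ, map_add, map_mul, map_mul, map_mul, hψ, hψ]
    ring
  · obtain ⟨⟨b, t⟩, hb⟩ := IsLocalization.surj S r
    have h := hψ_mul (z := r ^ p * z) (s := t * den z) (a := b ^ p * num z) (by
      simp only [map_mul, map_pow, ← hnum, ← hb]
      ring)
    refine ((hunit t.2).mul (hunit (hden z))).mul_left_cancel ?_
    change _ * ψ (r ^ p * z) = _ * (r * ψ z)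
    rw [← map_mul, h, hφ, map_mul, map_mul, hψ, ← hb]
    ring
  · simpa using hψ_mul (z := algebraMap A A' a) (s := 1) (a := a) (by simp)

include S in
theorem IsCartierCoordinates.exists_isLocalization (hp : p ≠ 0) {ι : Type*} [Fintype ι]
    {φ : ι → A →+ A} {e : ι → A} (hφ : IsCartierCoordinates p φ e) :
    ∃ φ' : ι → A' →+ A', IsCartierCoordinates p φ' (fun i => algebraMap A A' (e i)) ∧
      ∀ g, cartierIdeal φ' (algebraMap A A' g) = (cartierIdeal φ g).map (algebraMap A A') := by
  choose φ' hφ' hφ'φ using fun i =>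
    (hφ.isCartierLinear i).exists_isLocalization (A' := A') S hp
  refine ⟨φ', ⟨hφ', fun z => ?_⟩, fun g => ?_⟩
  · obtain ⟨s, hs, a, ha⟩ := exists_mul_algebraMap_pow_eq S hp z
    have hsu := (IsLocalization.map_units A' (⟨s, hs⟩ : S)).pow p
    refine hsu.mul_right_cancel ?_
    rw [ha, Finset.sum_mul]
    conv_rhs => rw [← hφ.sum_pow_mul a, map_sum]
    refine Finset.sum_congr rfl fun i _ => ?_
    rw [map_mul, map_pow, ← hφ'φ, ← ha, mul_comm z, hφ' i]
    ring
  · simp only [cartierIdeal, Ideal.map_span, ← Set.range_comp, Function.comp_def, hφ'φ]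

end Localization

section Homogeneous

open MvPolynomial

attribute [local instance] MvPolynomial.gradedAlgebra

variable {σ k : Type*} [Field k] {I : Ideal (MvPolynomial σ k)}

theorem le_idealOfVars_of_isHomogeneous (hI : I.IsHomogeneous (homogeneousSubmodule σ k))
    (h : I ≠ ⊤) : I ≤ idealOfVars σ k := by
  intro g hg
  rw [← pow_one (idealOfVars σ k), mem_pow_idealOfVars_iff']
  intro b hb
  obtain rfl := (Finsupp.degree_eq_zero_iff b).mp (Nat.lt_one_iff.mp hb)
  have h0 := (mem_iff_homogeneousComponent_mem hI g).mp hg 0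
  rw [homogeneousComponent_zero] at h0
  by_contra hne
  exact h (Ideal.eq_top_of_isUnit_mem _ h0 ((isUnit_iff_ne_zero.mpr hne).map C))

theorem forall_prime_lt_idealOfVars_iff [Finite σ]
    (hI : I.IsHomogeneous (homogeneousSubmodule σ k)) :
    (∀ (P : Ideal (MvPolynomial σ k)) [P.IsPrime], P < idealOfVars σ k → ¬ I ≤ P) ↔
      ∃ s, idealOfVars σ k ^ s ≤ I := by
  constructor
  · intro h
    refine Ideal.exists_pow_le_of_le_radical_of_fg ?_ (idealOfVars_fg σ k)
    rw [Ideal.radical_eq_sInf]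
    refine le_sInf fun P ⟨hIP, hP⟩ => ?_
    let Q := P.homogeneousCore (homogeneousSubmodule σ k)
    have hQ : Q.toIdeal.IsPrime := hP.homogeneousCore
    have hIQ : I ≤ Q.toIdeal :=
      hI.toIdeal_homogeneousCore_eq_self ▸ Ideal.homogeneousCore_mono _ hIP
    have hle := le_idealOfVars_of_isHomogeneous Q.isHomogeneous hQ.ne_top
    by_contra hne
    exact h Q.toIdeal (lt_of_le_of_ne hle fun heq =>
      hne (heq ▸ P.toIdeal_homogeneousCore_le (homogeneousSubmodule σ k))) hIQ
  · rintro ⟨s, hs⟩ P hP hlt hIP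
    exact hlt.not_ge (hP.le_of_pow_le (hs.trans hIP))

end Homogeneous

namespace Hypersurface

open MvPolynomial IsLocalRing

variable {k : Type u} [Field k] {p : ℕ} [Fact p.Prime] [CharP k p] {n : ℕ} {ι : Type*}
  [Fintype ι] {φ : ι → MvPolynomial (Fin (n + 1)) k →+ MvPolynomial (Fin (n + 1)) k}
  {e : ι → MvPolynomial (Fin (n + 1)) k} {f : MvPolynomial (Fin (n + 1)) k}

/-- The surjection `R_𝔭 → (R/fR)_𝔭`. -/
noncomputable def toLocAt (f : MvPolynomial (Fin (n + 1)) k)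
    (P : Ideal (MvPolynomial (Fin (n + 1)) k)) [P.IsPrime] :
    Localization.AtPrime P →+* LocAt f P :=
  IsLocalization.map (M := P.primeCompl) (T := Algebra.algebraMapSubmonoid (Quot f) P.primeCompl)
    (LocAt f P) (algebraMap _ (Quot f)) (Submonoid.le_comap_map P.primeCompl)

variable (P : Ideal (MvPolynomial (Fin (n + 1)) k)) [P.IsPrime]

theorem toLocAt_surjective : Function.Surjective (toLocAt f P) := by
  have : IsLocalization (P.primeCompl.map (algebraMap _ (Quot f))) (LocAt f P) :=
    Localization.isLocalization
  exact IsLocalization.map_surjective_of_surjective (g := algebraMap _ (Quot f)) P.primeCompl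
    (Localization.AtPrime P) (LocAt f P) Ideal.Quotient.mk_surjective

theorem ker_toLocAt :
    RingHom.ker (toLocAt f P) = Ideal.span {algebraMap _ (Localization.AtPrime P) f} := by
  refine (IsLocalization.ker_map (LocAt f P)
    (T := Algebra.algebraMapSubmonoid (Quot f) P.primeCompl)
    (algebraMap _ (Quot f)) rfl).trans ?_
  rw [Ideal.Quotient.algebraMap_eq, Ideal.mk_ker, Ideal.map_span, Set.image_singleton]

theorem isFPure_locAt_iff (hφ : IsCartierCoordinates p φ e) (hf0 : f ≠ 0) :
    IsFPure k p (LocAt f P) ↔ ¬ cartierIdeal φ (f ^ (p - 1)) ≤ P := by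
  obtain ⟨φ', hφ', hideal⟩ := hφ.exists_isLocalization (A' := Localization.AtPrime P)
    (S := P.primeCompl) (Fact.out : p.Prime).ne_zero
  have hf : algebraMap _ (Localization.AtPrime P) f ∈ nonZeroDivisors (Localization.AtPrime P) :=
    IsLocalization.map_nonZeroDivisors_le P.primeCompl _
      (Submonoid.mem_map_of_mem _ (mem_nonZeroDivisors_of_ne_zero hf0))
  have h := hφ'.isFPure_iff (k := k) (B := LocAt f P) (ρ := toLocAt f P)
    (toLocAt_surjective P) hf (ker_toLocAt P)
  rw [h, ← map_pow, hideal, Ideal.map_le_iff_le_comap, ← Ideal.under_def,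
    Localization.AtPrime.under_maximalIdeal]

theorem isFPure_locAt_zero (hφ : IsCartierCoordinates p φ e) : IsFPure k p (LocAt 0 P) := by
  obtain ⟨φ', hφ', -⟩ := hφ.exists_isLocalization (A' := Localization.AtPrime P)
    (S := P.primeCompl) (Fact.out : p.Prime).ne_zero
  obtain ⟨i, hi⟩ := hφ'.exists_isUnit_one (k := k)
  refine .of_surjective (hφ'.isCartierLinear i) (toLocAt_surjective P) (fun a ha => ?_) hi
  rw [ker_toLocAt, map_zero, Ideal.span_singleton_eq_bot.mpr rfl, Ideal.mem_bot] at ha ⊢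
  rw [ha, map_zero]

end Hypersurface

/-! ### Ideals generated by forms -/

section Forms

open MvPolynomial

theorem span_range_pow_le {R ι : Type*} [CommRing R] [Fintype ι] (F : ι → R) (q : ℕ) :
    Ideal.span (Set.range F) ^ (Fintype.card ι * (q - 1) + 1) ≤
      Ideal.span (Set.range fun i => F i ^ q) := by
  intro y hy
  obtain ⟨P, hP, rfl⟩ := (Ideal.mem_span_pow_iff_exists_isHomogeneous F y).mp hy
  rw [eval_eq']
  refine Ideal.sum_mem _ fun b hb => Ideal.mul_mem_left _ _ ?_
  have hdeg : b.degree = Fintype.card ι * (q - 1) + 1 :=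
    (hP.degree_eq_sum_deg_support hb).symm
  obtain ⟨i, hi⟩ : ∃ i, q ≤ b i := by
    by_contra! h
    have : b.degree ≤ Fintype.card ι * (q - 1) := by
      rw [Finsupp.degree_eq_sum]
      exact Finset.sum_le_card_nsmul _ _ _ fun i _ => Nat.le_sub_one_of_lt (h i)
    omega
  exact Ideal.mem_of_dvd _ ((pow_dvd_pow (F i) hi).trans
    (Finset.dvd_prod_of_mem (fun i => F i ^ b i) (Finset.mem_univ i)))
    (Ideal.subset_span (Set.mem_range_self i))

variable {σ ι R : Type*} [CommRing R]

theorem homogeneousComponent_mul_of_isHomogeneous {F g : MvPolynomial σ R} {D j : ℕ}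
    (hF : F.IsHomogeneous D) (h : D ≤ j) :
    homogeneousComponent j (F * g) = F * homogeneousComponent (j - D) g := by
  let _ : GradedAlgebra (homogeneousSubmodule σ R) := gradedAlgebra
  simp only [← decomposition.decompose'_apply]
  exact DirectSum.coe_decompose_mul_of_left_mem_of_le (homogeneousSubmodule σ R)
    ((mem_homogeneousSubmodule D F).mpr hF) h

theorem mem_pow_idealOfVars_of_isHomogeneous {s j : ℕ} {g : MvPolynomial σ R}
    (hg : g.IsHomogeneous j) (hj : s ≤ j) : g ∈ idealOfVars σ R ^ s :=
  (mem_pow_idealOfVars_iff s g).mpr fun _ hx => hj.trans (hg.degree_eq_sum_deg_support hx).le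

theorem exists_isHomogeneous_sum_mul_eq [Fintype ι] {F : ι → MvPolynomial σ R}
    {g : MvPolynomial σ R} {D j : ℕ} (hF : ∀ i, (F i).IsHomogeneous D)
    (hmem : g ∈ Ideal.span (Set.range F)) (hg : g.IsHomogeneous j) (hj : D ≤ j) :
    ∃ a : ι → MvPolynomial σ R, (∀ i, (a i).IsHomogeneous (j - D)) ∧ ∑ i, a i * F i = g := by
  obtain ⟨c, hc⟩ := Ideal.mem_span_range_iff_exists_fun.mp hmem
  refine ⟨fun i => homogeneousComponent (j - D) (c i),
    fun i => homogeneousComponent_isHomogeneous (j - D) (c i), ?_⟩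
  have hgj : homogeneousComponent j g = g := by rw [homogeneousComponent_of_mem hg, if_pos rfl]
  conv_rhs => rw [← hgj, ← hc, map_sum]
  refine Finset.sum_congr rfl fun i _ => ?_
  rw [mul_comm (c i), homogeneousComponent_mul_of_isHomogeneous (hF i) hj, mul_comm]

theorem mem_span_pow_of_isHomogeneous [Finite ι] {F : ι → MvPolynomial σ R} {D s : ℕ}
    (hF : ∀ i, (F i).IsHomogeneous D) (hs : idealOfVars σ R ^ s ≤ Ideal.span (Set.range F))
    (l : ℕ) {g : MvPolynomial σ R} {j : ℕ} (hg : g.IsHomogeneous j) (hj : s + D * l ≤ j) :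
    g ∈ Ideal.span (Set.range F) ^ (l + 1) := by
  have := Fintype.ofFinite ι
  have hmem : g ∈ Ideal.span (Set.range F) :=
    hs (mem_pow_idealOfVars_of_isHomogeneous hg ((Nat.le_add_right _ _).trans hj))
  induction l generalizing g j with
  | zero => rwa [zero_add, pow_one]
  | succ l ih =>
    rw [mul_add_one] at hj
    obtain ⟨a, ha, rfl⟩ := exists_isHomogeneous_sum_mul_eq hF hmem hg (by omega)
    rw [pow_succ]
    refine Ideal.sum_mem _ fun i _ =>
      Ideal.mul_mem_mul ?_ (Ideal.subset_span (Set.mem_range_self i))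
    have hdeg : s + D * l ≤ j - D := by omega
    exact ih (ha i) hdeg
      (hs (mem_pow_idealOfVars_of_isHomogeneous (ha i) ((Nat.le_add_right _ _).trans hdeg)))

variable {K : Type*} [Field K]

/- For `q = p ^ e` large, `x ^ (q a + q - 1)` lies in the ideal generated by the `F i ^ q`; the
Cartier operator for `q` takes it to `x ^ a` and this ideal into the one generated by the `F i`. -/
theorem monomial_mem_span_of_isHomogeneous (p : ℕ) [Fact p.Prime] [CharP K p] [PerfectRing K p]
    [Fintype σ] [Fintype ι] {F : ι → MvPolynomial σ K} {D s : ℕ} (hF : ∀ i, (F i).IsHomogeneous D)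
    (hs : idealOfVars σ K ^ s ≤ Ideal.span (Set.range F)) {a : σ →₀ ℕ}
    (ha : Fintype.card ι * D < a.degree + Fintype.card σ) :
    monomial a 1 ∈ Ideal.span (Set.range F) := by
  obtain ⟨e, he⟩ : ∃ e, s + Fintype.card σ ≤ p ^ e :=
    ⟨_, (Nat.lt_pow_self (Fact.out : p.Prime).one_lt).le⟩
  obtain ⟨q, hq⟩ : ∃ q, p ^ e = q + 1 := Nat.exists_eq_add_one.mpr (NeZero.pos (p ^ e))
  let π : K →+ K := (iterateFrobeniusEquiv K p e).symm
  have hπ : IsCartierLinear (q + 1) π := fun r c => by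
    change (iterateFrobeniusEquiv K p e).symm (r ^ (q + 1) * c) = r * _
    rw [← hq, ← iterateFrobeniusEquiv_def, map_mul, RingEquiv.symm_apply_apply]
    rfl
  let α : σ →₀ ℕ := Finsupp.equivFunOnFinite.symm fun _ => q
  have hαdeg : α.degree = Fintype.card σ * q := by simp [Finsupp.degree_eq_sum, α]
  have hmem : monomial ((q + 1) • a + α) 1 ∈ Ideal.span (Set.range fun i => F i ^ (q + 1)) := by
    refine span_range_pow_le F (q + 1) (mem_span_pow_of_isHomogeneous hF hs
      (Fintype.card ι * q) (isHomogeneous_monomial (1 : K) rfl) ?_)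
    rw [map_add, map_nsmul, smul_eq_mul, hαdeg]
    nlinarith
  have := (isCartierLinear_cartier hq.symm hπ (α := α)
    fun _ => Nat.lt_succ_self q).apply_mem_of_mem_span_pow hmem
  rwa [cartier_monomial_smul_add, show π 1 = 1 from map_one (iterateFrobeniusEquiv K p e).symm]
    at this

theorem aeval_smul_of_isHomogeneous {A : Type*} [CommRing A] [Algebra R A]
    {H : MvPolynomial σ R} {δ : ℕ} (hH : H.IsHomogeneous δ) (c : σ → R) (y : A) :
    aeval (fun i => c i • y) H = eval c H • y ^ δ := by
  rw [aeval_def, eval₂_eq, eval_eq, Finset.sum_smul]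
  refine Finset.sum_congr rfl fun b hb => ?_
  have hdeg : ∑ i ∈ b.support, b i = δ := (hH.degree_eq_sum_deg_support hb).symm
  simp only [smul_pow]
  rw [Finset.prod_smul, Finset.prod_pow_eq_pow_sum, hdeg, mul_smul, Algebra.smul_def (coeff b H)]

theorem pow_mem_of_sub_smul_mem {A : Type*} [CommRing A] [Algebra K A] {I : Ideal A}
    {H : MvPolynomial σ K} {δ : ℕ} (hH : H.IsHomogeneous δ) {G : σ → A} (hHG : aeval G H ∈ I)
    {c : σ → K} (hc : eval c H ≠ 0) {y : A} (hy : ∀ i, G i - c i • y ∈ I) : y ^ δ ∈ I := by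
  have hmk : (fun i => Ideal.Quotient.mkₐ K I (G i)) =
      fun i => c i • Ideal.Quotient.mkₐ K I y := by
    funext i
    rw [← map_smul, ← sub_eq_zero, ← map_sub]
    exact Ideal.Quotient.eq_zero_iff_mem.mpr (hy i)
  have hzero : Ideal.Quotient.mkₐ K I (aeval G H) = 0 := Ideal.Quotient.eq_zero_iff_mem.mpr hHG
  rw [← AlgHom.comp_apply, comp_aeval, hmk, aeval_smul_of_isHomogeneous hH, ← map_pow] at hzero
  exact Ideal.Quotient.eq_zero_iff_mem.mp ((smul_eq_zero_iff_right hc).mp hzero)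

theorem homogeneousComponent_aeval {τ : Type*} {D : ℕ} (hD : 0 < D) {G : ι → MvPolynomial τ R}
    (hG : ∀ i, (G i).IsHomogeneous D) (H : MvPolynomial ι R) (j : ℕ) :
    homogeneousComponent (D * j) (aeval G H) = aeval G (homogeneousComponent j H) := by
  have hcomp (i : ℕ) : homogeneousComponent (D * j) (aeval G (homogeneousComponent i H)) =
      if i = j then aeval G (homogeneousComponent j H) else 0 := by
    rw [homogeneousComponent_of_mem ((homogeneousComponent_isHomogeneous i H).aeval G hG)]
    rcases eq_or_ne i j with rfl | h
    · simp
    · rw [if_neg fun h' => h (Nat.eq_of_mul_eq_mul_left hD h').symm, if_neg h]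
  conv_lhs => rw [← sum_homogeneousComponent H]
  simp only [map_sum, hcomp]
  rw [Finset.sum_ite_eq']
  refine ite_eq_left_iff.mpr fun h => ?_
  rw [homogeneousComponent_eq_zero _ _ (by simpa using h), map_zero]

theorem exists_isHomogeneous_aeval_eq_zero {N L D : ℕ} (hD : 0 < D) (hL : N < L)
    {G : Fin L → MvPolynomial (Fin N) K} (hG : ∀ i, (G i).IsHomogeneous D) :
    ∃ (H : MvPolynomial (Fin L) K) (δ : ℕ), H ≠ 0 ∧ H.IsHomogeneous δ ∧ aeval G H = 0 := by
  have hdep : ¬ AlgebraicIndependent K G := fun h => by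
    have hle := h.lift_cardinalMk_le_trdeg
    rw [MvPolynomial.trdeg_of_isDomain] at hle
    simp only [Cardinal.mk_fintype, Fintype.card_fin, Cardinal.lift_natCast, Nat.cast_le] at hle
    omega
  rw [algebraicIndependent_iff] at hdep
  push Not at hdep
  obtain ⟨H, hHG, hH0⟩ := hdep
  obtain ⟨b, hb⟩ := ne_zero_iff.mp hH0
  refine ⟨homogeneousComponent b.degree H, b.degree, fun h => hb ?_,
    homogeneousComponent_isHomogeneous _ _, ?_⟩
  · rw [← coeff_zero b, ← h, coeff_homogeneousComponent, if_pos rfl]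
  · rw [← homogeneousComponent_aeval hD hG, hHG, map_zero]

theorem exists_forms_of_lt [Infinite K] {N L D : ℕ} (hD : 0 < D) (hL : N < L + 1)
    {G : Fin (L + 1) → MvPolynomial (Fin N) K} (hG : ∀ i, (G i).IsHomogeneous D) :
    ∃ G' : Fin L → MvPolynomial (Fin N) K, (∀ i, (G' i).IsHomogeneous D) ∧
      Ideal.span (Set.range G') ≤ Ideal.span (Set.range G) ∧
      Ideal.span (Set.range G) ≤ (Ideal.span (Set.range G')).radical := by
  obtain ⟨H, δ, hH0, hH, hHG⟩ := exists_isHomogeneous_aeval_eq_zero hD hL hG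
  obtain ⟨c, hc⟩ : ∃ c, eval c (H * X 0) ≠ 0 := by
    by_contra! h
    exact mul_ne_zero hH0 (X_ne_zero 0) (MvPolynomial.funext fun x => by rw [h x, map_zero])
  rw [map_mul, eval_X] at hc
  set y := (c 0)⁻¹ • G 0
  have hG0 : G 0 = c 0 • y := (smul_inv_smul₀ (right_ne_zero_of_mul hc) _).symm
  refine ⟨fun i => G i.succ - c i.succ • y, fun i => ?_, ?_, ?_⟩
  · refine (hG _).sub ((homogeneousSubmodule (Fin N) K D).smul_mem _ ?_)
    exact (homogeneousSubmodule (Fin N) K D).smul_mem _ (hG 0)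
  · rw [Ideal.span_le, Set.range_subset_iff]
    intro i
    have hmem := fun i => Ideal.subset_span (Set.mem_range_self (f := G) i)
    exact sub_mem (hmem _)
      (Submodule.smul_of_tower_mem _ _ (Submodule.smul_of_tower_mem _ _ (hmem 0)))
  · set I := Ideal.span (Set.range fun i : Fin L => G i.succ - c i.succ • y)
    have hsub (i : Fin (L + 1)) : G i - c i • y ∈ I := by
      cases i using Fin.cases with
      | zero => rw [hG0, sub_self]; exact I.zero_mem
      | succ i => exact Ideal.subset_span (Set.mem_range_self i)
    have hyI : y ∈ I.radical :=
      ⟨δ, pow_mem_of_sub_smul_mem hH (hHG ▸ I.zero_mem) (left_ne_zero_of_mul hc) hsub⟩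
    rw [Ideal.span_le, Set.range_subset_iff]
    intro i
    rw [← sub_add_cancel (G i) (c i • y)]
    exact add_mem (Ideal.le_radical (hsub i)) (Submodule.smul_of_tower_mem _ _ hyI)

theorem exists_forms_radical_of_le [Infinite K] {N L D : ℕ} (hD : 0 < D) (hL : N ≤ L)
    {G : Fin L → MvPolynomial (Fin N) K} (hG : ∀ i, (G i).IsHomogeneous D) :
    ∃ F : Fin N → MvPolynomial (Fin N) K, (∀ i, (F i).IsHomogeneous D) ∧
      Ideal.span (Set.range F) ≤ Ideal.span (Set.range G) ∧
      Ideal.span (Set.range G) ≤ (Ideal.span (Set.range F)).radical := by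
  induction L, hL using Nat.le_induction with
  | base => exact ⟨G, hG, le_rfl, Ideal.le_radical⟩
  | succ L hL ih =>
    obtain ⟨G', hG', hle, hrad⟩ := exists_forms_of_lt hD (Nat.lt_succ_of_le hL) hG
    obtain ⟨F, hF, hle', hrad'⟩ := ih hG'
    exact ⟨F, hF, hle'.trans hle, hrad.trans (Ideal.radical_le_radical_iff.mpr hrad')⟩

theorem exists_forms_radical [Infinite K] [Finite ι] {N D : ℕ} (hD : 0 < D)
    {G : ι → MvPolynomial (Fin N) K} (hG : ∀ i, (G i).IsHomogeneous D) :
    ∃ F : Fin N → MvPolynomial (Fin N) K, (∀ i, (F i).IsHomogeneous D) ∧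
      Ideal.span (Set.range F) ≤ Ideal.span (Set.range G) ∧
      Ideal.span (Set.range G) ≤ (Ideal.span (Set.range F)).radical := by
  have := Fintype.ofFinite ι
  let E := Fintype.equivFin (ι ⊕ Fin N)
  have hG' : ∀ i : ι ⊕ Fin N, (Sum.elim G 0 i).IsHomogeneous D := by
    rintro (i | _)
    exacts [hG i, isHomogeneous_zero _ _ _]
  have hspan : Ideal.span (Set.range (Sum.elim G 0 ∘ E.symm)) = Ideal.span (Set.range G) := by
    rw [E.symm.surjective.range_comp, Set.Sum.elim_range, Ideal.span_union,
      sup_eq_left, Ideal.span_le]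
    rintro _ ⟨_, rfl⟩
    exact Ideal.zero_mem _
  rw [← hspan]
  exact exists_forms_radical_of_le hD (by simp) fun i => hG' (E.symm i)

theorem mem_span_of_map_mem_span {k : Type*} [Field k] [Algebra k K] [Finite ι]
    {g : ι → MvPolynomial σ k} {h : MvPolynomial σ k}
    (hh : map (algebraMap k K) h ∈ Ideal.span (Set.range fun i => map (algebraMap k K) (g i))) :
    h ∈ Ideal.span (Set.range g) := by
  classical
  have := Fintype.ofFinite ι
  obtain ⟨ρ, hρ⟩ := LinearMap.exists_leftInverse_of_injective (Algebra.linearMap k K)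
    (LinearMap.ker_eq_bot.mpr (algebraMap k K).injective)
  have hρ1 (c : k) : ρ (algebraMap k K c) = c := LinearMap.congr_fun hρ c
  obtain ⟨c, hc⟩ := Ideal.mem_span_range_iff_exists_fun.mp hh
  let T (x : MvPolynomial σ K) : MvPolynomial σ k := AddMonoidAlgebra.map ρ.toAddMonoidHom x
  have hT (x : MvPolynomial σ K) (m : σ →₀ ℕ) : coeff m (T x) = ρ (coeff m x) := by
    simp [T, coeff]
  refine Ideal.mem_span_range_iff_exists_fun.mpr ⟨fun i => T (c i), ?_⟩
  ext m
  have hcm := congrArg (fun x => ρ (coeff m x)) hc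
  simp only [coeff_sum, coeff_mul, coeff_map, map_sum, hρ1] at hcm
  simp only [coeff_sum, coeff_mul, hT]
  rw [← hcm]
  refine Finset.sum_congr rfl fun i _ => Finset.sum_congr rfl fun x _ => ?_
  rw [mul_comm (coeff _ (c i)), ← Algebra.smul_def, map_smul, smul_eq_mul, mul_comm]

theorem exists_forms_pow_le [Infinite K] [Finite ι] {N D s : ℕ} (hD : 0 < D)
    {g : ι → MvPolynomial (Fin N) K} (hg : ∀ i, ∃ m ≤ D, (g i).IsHomogeneous m)
    (hs : idealOfVars (Fin N) K ^ s ≤ Ideal.span (Set.range g)) :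
    ∃ (F : Fin N → MvPolynomial (Fin N) K) (t : ℕ), (∀ i, (F i).IsHomogeneous D) ∧
      Ideal.span (Set.range F) ≤ Ideal.span (Set.range g) ∧
      idealOfVars (Fin N) K ^ t ≤ Ideal.span (Set.range F) := by
  choose m hmD hm using hg
  let G (l : ι × Fin N) : MvPolynomial (Fin N) K := g l.1 * X l.2 ^ (D - m l.1)
  have hG (l) : (G l).IsHomogeneous D := by
    have := (hm l.1).mul ((isHomogeneous_X K l.2).pow (D - m l.1))
    rwa [one_mul, Nat.add_sub_cancel' (hmD _)] at this
  have hmul (j : Fin N) :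
      Ideal.span (Set.range g) * Ideal.span {X j ^ D} ≤ Ideal.span (Set.range G) := by
    rw [Ideal.span_mul_span', Ideal.span_le]
    rintro _ ⟨_, ⟨i, rfl⟩, _, rfl, rfl⟩
    refine Ideal.mem_of_dvd _ ?_ (Ideal.subset_span (Set.mem_range_self (i, j)))
    exact mul_dvd_mul_left _ (pow_dvd_pow _ (Nat.sub_le _ _))
  have hXrad (j : Fin N) : X j ∈ (Ideal.span (Set.range G)).radical := by
    refine ⟨s + D, hmul j ?_⟩
    rw [pow_add]
    exact Ideal.mul_mem_mul
      (hs (Ideal.pow_mem_pow (Ideal.subset_span (Set.mem_range_self j)) s))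
      (Ideal.mem_span_singleton_self _)
  obtain ⟨F, hF, hFG, hGF⟩ := exists_forms_radical hD hG
  have hrad : idealOfVars (Fin N) K ≤ (Ideal.span (Set.range F)).radical := by
    rw [idealOfVars, Ideal.span_le, Set.range_subset_iff]
    exact fun j => Ideal.radical_le_radical_iff.mpr hGF (hXrad j)
  obtain ⟨t, ht⟩ := Ideal.exists_pow_le_of_le_radical_of_fg hrad (idealOfVars_fg _ _)
  refine ⟨F, t, hF, hFG.trans ?_, ht⟩
  rw [Ideal.span_le, Set.range_subset_iff]
  exact fun l => Ideal.mul_mem_right _ _ (Ideal.subset_span (Set.mem_range_self l.1))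

theorem monomial_mem_span_of_pow_le {k : Type*} [Field k] (p : ℕ) [Fact p.Prime] [CharP k p]
    [Finite ι] {N D s : ℕ} (hD : 0 < D) {g : ι → MvPolynomial (Fin N) k}
    (hg : ∀ i, ∃ m ≤ D, (g i).IsHomogeneous m)
    (hs : idealOfVars (Fin N) k ^ s ≤ Ideal.span (Set.range g))
    {a : Fin N →₀ ℕ} (ha : N * (D - 1) < a.degree) :
    monomial a 1 ∈ Ideal.span (Set.range g) := by
  let K := AlgebraicClosure k
  have : CharP K p := charP_of_injective_algebraMap (algebraMap k K).injective p
  have hsK : idealOfVars (Fin N) K ^ s ≤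
      Ideal.span (Set.range fun i => map (algebraMap k K) (g i)) := by
    have := Ideal.map_mono (f := map (algebraMap k K)) hs
    simpa only [Ideal.map_pow, idealOfVars, Ideal.map_span, ← Set.range_comp,
      Function.comp_def, map_X] using this
  obtain ⟨F, t, hF, hle, ht⟩ := exists_forms_pow_le hD
    (fun i => (hg i).imp fun _ h => ⟨h.1, h.2.map (algebraMap k K)⟩) hsK
  refine mem_span_of_map_mem_span (K := K) ?_
  rw [map_monomial, map_one]
  refine hle (monomial_mem_span_of_isHomogeneous p hF ht ?_)
  obtain ⟨D, rfl⟩ := Nat.exists_eq_add_one.mpr hD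
  simp only [Fintype.card_fin, Nat.add_sub_cancel] at ha ⊢
  linarith

end Forms

/-! ### Koszul and Čech differentials -/

/-- A family that is weakly regular in every order: each member is a nonzerodivisor modulo the ideal
generated by any finitely many of the others. -/
def IsWeaklyRegularFamily {A σ : Type*} [CommRing A] (y : σ → A) : Prop :=
  ∀ (S : Finset σ) (j : σ) (g : A), j ∉ S →
    g * y j ∈ Ideal.span (y '' S) → g ∈ Ideal.span (y '' S)

namespace IsWeaklyRegularFamily

variable {A σ : Type*} [CommRing A] [Fintype σ] {y : σ → A}

theorem exists_sum_eq_apply (hy : IsWeaklyRegularFamily y) {S : Finset σ} {j : σ} (hj : j ∉ S)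
    {g : σ → A} (hS : ∀ i, i ≠ j → i ∉ S → g i = 0) (hg : ∑ i, g i * y i = 0) :
    ∃ c : σ → A, (∀ l ∉ S, c l = 0) ∧ ∑ l, c l * y l = g j := by
  classical
  have hgj : g j * y j ∈ Ideal.span (y '' S) := by
    rw [← Finset.add_sum_erase _ _ (Finset.mem_univ j)] at hg
    rw [eq_neg_of_add_eq_zero_left hg]
    refine neg_mem (Ideal.sum_mem _ fun i hi => ?_)
    by_cases hiS : i ∈ S
    · exact Ideal.mul_mem_left _ _ (Ideal.subset_span ⟨i, hiS, rfl⟩)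
    · rw [hS i (Finset.ne_of_mem_erase hi) hiS, zero_mul]
      exact Ideal.zero_mem _
  obtain ⟨c, hcS, hc⟩ := (Finsupp.mem_span_image_iff_linearCombination A).mp (hy S j _ hj hgj)
  refine ⟨c, fun l hl => ?_, ?_⟩
  · by_contra h
    exact hl (hcS (Finsupp.mem_support_iff.mpr h))
  · rw [← hc, Finsupp.linearCombination_apply, Finsupp.sum_fintype _ _ (by simp)]
    rfl

theorem exists_alternating_of_forall_notMem (hy : IsWeaklyRegularFamily y) (S : Finset σ)
    {g : σ → A} (hS : ∀ i ∉ S, g i = 0) (hg : ∑ i, g i * y i = 0) :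
    ∃ a : σ → σ → A, (∀ i, a i i = 0) ∧ (∀ i j, a i j = -a j i) ∧
      ∀ i, g i = ∑ j, a i j * y j := by
  classical
  induction S using Finset.induction_on generalizing g with
  | empty => exact ⟨0, by simp, by simp, fun i => by simpa using hS i (Finset.notMem_empty i)⟩
  | insert j S hj ih =>
    obtain ⟨c, hcS, hc⟩ := hy.exists_sum_eq_apply hj (fun i hij hi => hS i (by simp [hij, hi])) hg
    have hw (i : σ) : ∑ l, ((if i = j then c l else 0) - if l = j then c i else 0) * y l =
        (if i = j then g j else 0) - c i * y j := by
      simp only [sub_mul, ite_mul, zero_mul, Finset.sum_sub_distrib, Finset.sum_ite_eq',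
        Finset.mem_univ, if_true]
      split_ifs
      · rw [hc]
      · rw [Finset.sum_const_zero]
    obtain ⟨a, ha0, ha, hga⟩ := @ih (fun i => g i - ((if i = j then g j else 0) - c i * y j))
      (fun i hi => by
        rcases eq_or_ne i j with rfl | hij
        · simp [hcS i hi]
        · simp [hcS i hi, hij, hS i (by simp [hij, hi])])
      (by
        have hcj : ∑ i, c i * y j * y i = g j * y j := by
          rw [← hc, Finset.sum_mul]
          exact Finset.sum_congr rfl fun i _ => mul_right_comm _ _ _
        simp [sub_mul, Finset.sum_sub_distrib, hg, hcj])
    refine ⟨fun i l => a i l + ((if i = j then c l else 0) - if l = j then c i else 0),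
      fun i => by simp [ha0], fun i l => ?_, fun i => ?_⟩
    · dsimp only
      rw [ha]
      ring
    · simp only [add_mul, Finset.sum_add_distrib, ← hga, hw, sub_add_cancel]

theorem exists_alternating (hy : IsWeaklyRegularFamily y) {g : σ → A}
    (hg : ∑ i, g i * y i = 0) :
    ∃ a : σ → σ → A, (∀ i, a i i = 0) ∧ (∀ i j, a i j = -a j i) ∧
      ∀ i, g i = ∑ j, a i j * y j :=
  hy.exists_alternating_of_forall_notMem Finset.univ (by simp) hg

end IsWeaklyRegularFamily

namespace Cech

section Sign

variable {m : ℕ} {i j : Fin m} {J : Finset (Fin m)}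

/-- The sign of `j` in the component of the Čech differential at `J`. -/
def sign (j : Fin m) (J : Finset (Fin m)) : ℤ := (-1) ^ (J.filter (· < j)).card

theorem sign_mul_self (j : Fin m) (J : Finset (Fin m)) : sign j J * sign j J = 1 := by
  rw [sign, ← pow_add, ← two_mul, pow_mul, neg_one_sq, one_pow]

theorem sign_erase_of_lt (h : i < j) (J : Finset (Fin m)) : sign i (J.erase j) = sign i J := by
  rw [sign, sign, Finset.filter_erase, Finset.erase_eq_of_notMem]
  simp [h.not_gt]

theorem sign_erase_of_gt (h : i < j) (hi : i ∈ J) : sign j (J.erase i) = -sign j J := by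
  have hmem : i ∈ J.filter (· < j) := by simp [hi, h]
  rw [sign, sign, Finset.filter_erase, ← Finset.card_erase_add_one hmem, pow_succ, mul_neg_one,
    neg_neg]

theorem sign_mul_sign_erase (h : i ≠ j) (hi : i ∈ J) (hj : j ∈ J) :
    sign j J * sign i (J.erase j) = -(sign i J * sign j (J.erase i)) := by
  rcases h.lt_or_gt with h | h
  · rw [sign_erase_of_lt h, sign_erase_of_gt h hi]
    ring
  · rw [sign_erase_of_lt h, sign_erase_of_gt h hj]
    ring

end Sign

section Koszul

variable {A : Type*} [CommRing A] {m : ℕ}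

/-- The differential of the Koszul cochain complex of `y`, on cochains of all degrees at once. For
`y = x ^ t` it is the Čech differential on the numerators of fractions with denominators
`x_I ^ t`. -/
def koszulDiff (y : Fin m → A) : (Finset (Fin m) → A) →ₗ[A] Finset (Fin m) → A where
  toFun e J := ∑ j ∈ J, sign j J • (e (J.erase j) * y j)
  map_add' e e' := by
    funext J
    simp only [Pi.add_apply, add_mul, smul_add, Finset.sum_add_distrib]
  map_smul' a e := by
    funext J
    simp only [Pi.smul_apply, smul_eq_mul, RingHom.id_apply, Finset.mul_sum, mul_assoc,
      mul_smul_comm]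

theorem koszulDiff_apply (y : Fin m → A) (e : Finset (Fin m) → A) (J : Finset (Fin m)) :
    koszulDiff y e J = ∑ j ∈ J, sign j J • (e (J.erase j) * y j) := rfl

theorem map_koszulDiff {B : Type*} [CommRing B] (ψ : A →+* B) (y : Fin m → A)
    (e : Finset (Fin m) → A) : ψ ∘ koszulDiff y e = koszulDiff (ψ ∘ y) (ψ ∘ e) := by
  funext J
  simp [koszulDiff_apply]

theorem koszulDiff_koszulDiff (y : Fin m → A) (e : Finset (Fin m) → A) :
    koszulDiff y (koszulDiff y e) = 0 := by
  funext J
  simp only [koszulDiff_apply, Finset.sum_mul, Finset.smul_sum, Pi.zero_apply]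
  rw [Finset.sum_sigma']
  refine Finset.sum_involution (fun q _ => ⟨q.2, q.1⟩) ?_ ?_ ?_ (fun _ _ => rfl)
  · rintro ⟨j, i⟩ h
    obtain ⟨hj, hij, hi⟩ : j ∈ J ∧ i ≠ j ∧ i ∈ J := by simpa using h
    dsimp only
    rw [Finset.erase_right_comm, smul_mul_assoc, smul_mul_assoc, smul_smul, smul_smul,
      sign_mul_sign_erase hij hi hj, neg_smul, mul_right_comm, neg_add_cancel]
  · rintro ⟨j, i⟩ h _ h'
    simp only [Finset.mem_sigma, Finset.mem_erase] at h
    exact h.2.1 (congrArg Sigma.fst h')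
  · rintro ⟨j, i⟩ h
    simp only [Finset.mem_sigma, Finset.mem_erase] at h ⊢
    exact ⟨h.2.2, h.2.1.symm, h.1⟩

theorem koszulDiff_eq_zero_of_card_ne {y : Fin m → A} {i : ℕ} {e : Finset (Fin m) → A}
    (he : ∀ I, I.card + 1 ≠ i → e I = 0) {J : Finset (Fin m)} (hJ : J.card ≠ i) :
    koszulDiff y e J = 0 :=
  Finset.sum_eq_zero fun j hj => by
    rw [he _ (by rwa [Finset.card_erase_add_one hj]), zero_mul, smul_zero]

theorem koszulDiff_mem_span_range (y : Fin m → A) (e : Finset (Fin m) → A) (J : Finset (Fin m)) :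
    koszulDiff y e J ∈ Ideal.span (Set.range y) :=
  Ideal.sum_mem _ fun j _ =>
    zsmul_mem (Ideal.mul_mem_left _ _ (Ideal.subset_span (Set.mem_range_self j))) _

/-- Rescales the component at `I` of a family of numerators by `z_I`, the product of the `z_l` with
`l ∈ I`. -/
def scale (z : Fin m → A) : (Finset (Fin m) → A) →ₗ[A] Finset (Fin m) → A :=
  LinearMap.pi fun I => (∏ l ∈ I, z l) • LinearMap.proj I

theorem scale_apply (z : Fin m → A) (e : Finset (Fin m) → A) (I : Finset (Fin m)) :
    scale z e I = (∏ l ∈ I, z l) * e I := rfl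

theorem map_scale {B : Type*} [CommRing B] (ψ : A →+* B) (z : Fin m → A)
    (e : Finset (Fin m) → A) : ψ ∘ scale z e = scale (ψ ∘ z) (ψ ∘ e) := by
  funext I
  simp [scale_apply]

theorem koszulDiff_scale (y z : Fin m → A) (e : Finset (Fin m) → A) :
    koszulDiff (y * z) (scale z e) = scale z (koszulDiff y e) := by
  funext J
  rw [koszulDiff_apply, scale_apply, koszulDiff_apply, Finset.mul_sum]
  refine Finset.sum_congr rfl fun j hj => ?_
  rw [scale_apply, Pi.mul_apply, mul_smul_comm, ← Finset.prod_erase_mul J z hj]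
  congr 1
  ring

theorem exists_eq_univ_erase {n : ℕ} {I : Finset (Fin (n + 1))} (hI : I.card = n) :
    ∃ i, I = Finset.univ.erase i := by
  obtain ⟨i, hi⟩ := Finset.card_eq_one.mp (show Iᶜ.card = 1 by simp [Finset.card_compl, hI])
  exact ⟨i, by rw [← compl_compl I, hi, Finset.compl_singleton]⟩

theorem exists_koszulDiff_univ_eq {n : ℕ} (y a : Fin (n + 1) → A) :
    ∃ w : Finset (Fin (n + 1)) → A, (∀ I, I.card ≠ n → w I = 0) ∧
      (∀ i, w (Finset.univ.erase i) = sign i Finset.univ • a i) ∧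
      koszulDiff y w Finset.univ = ∑ i, a i * y i := by
  have hw : ∀ i : Fin (n + 1), (if (Finset.univ.erase i).card = n then
      ∑ j ∈ (Finset.univ.erase i)ᶜ, sign j Finset.univ • a j else 0) = sign i Finset.univ • a i :=
    fun i => by rw [if_pos (by simp), Finset.compl_erase, Finset.compl_univ, insert_empty_eq,
      Finset.sum_singleton]
  refine ⟨fun I => if I.card = n then ∑ j ∈ Iᶜ, sign j Finset.univ • a j else 0,
    fun I hI => if_neg hI, hw, ?_⟩
  rw [koszulDiff_apply]
  refine Finset.sum_congr rfl fun i _ => ?_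
  rw [hw, smul_mul_assoc, smul_smul, sign_mul_self, one_smul]

theorem exists_apply_erase_erase_eq {n : ℕ} {v : Fin (n + 1) → Fin (n + 1) → A}
    (hv : ∀ i j, i ≠ j → v i j = v j i) :
    ∃ b : Finset (Fin (n + 1)) → A, (∀ I, I.card + 1 ≠ n → b I = 0) ∧
      ∀ i j, i ≠ j → b ((Finset.univ.erase i).erase j) = v i j := by
  let F (q : {q : Fin (n + 1) × Fin (n + 1) // q.1 ≠ q.2}) : Finset (Fin (n + 1)) :=
    (Finset.univ.erase q.1.1).erase q.1.2
  have hF : Function.FactorsThrough (fun q => v q.1.1 q.1.2) F := by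
    rintro ⟨⟨i, j⟩, hij⟩ ⟨⟨i', j'⟩, hij'⟩ h
    have hmem (l : Fin (n + 1)) := Finset.ext_iff.mp h l
    simp only [F, Finset.mem_erase, Finset.mem_univ, and_true] at hmem hij hij' ⊢
    obtain ⟨rfl, rfl⟩ | ⟨rfl, rfl⟩ : i = i' ∧ j = j' ∨ i = j' ∧ j = i' := by
      grind [hmem i, hmem j]
    exacts [rfl, hv _ _ hij]
  refine ⟨Function.extend F (fun q => v q.1.1 q.1.2) 0, fun I hI => ?_, fun i j hij =>
    hF.extend_apply 0 ⟨(i, j), hij⟩⟩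
  refine Function.extend_apply' _ _ _ ?_
  rintro ⟨⟨⟨i, j⟩, hij⟩, rfl⟩
  refine hI ?_
  rw [Finset.card_erase_add_one (by simpa using hij.symm), Finset.card_erase_of_mem (by simp)]
  simp

theorem exists_koszulDiff_eq {n : ℕ} {y : Fin (n + 1) → A} (hy : IsWeaklyRegularFamily y)
    {e : Finset (Fin (n + 1)) → A} (he : ∀ I, I.card ≠ n → e I = 0)
    (h0 : koszulDiff y e Finset.univ = 0) :
    ∃ b, (∀ I, I.card + 1 ≠ n → b I = 0) ∧ koszulDiff y b = e := by
  obtain ⟨a, ha0, ha, hea⟩ := hy.exists_alternating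
    (g := fun i => sign i Finset.univ • e (Finset.univ.erase i)) (by
      rw [← h0, koszulDiff_apply]
      exact Finset.sum_congr rfl fun j _ => smul_mul_assoc _ _ _)
  obtain ⟨b, hb, hba⟩ := exists_apply_erase_erase_eq
    (v := fun i j => (sign i Finset.univ * sign j (Finset.univ.erase i)) • a i j)
    fun i j hij => by
      rw [ha i j, smul_neg, ← neg_smul,
        ← sign_mul_sign_erase hij (Finset.mem_univ i) (Finset.mem_univ j)]
  refine ⟨b, hb, funext fun I => ?_⟩
  by_cases hI : I.card = n
  · obtain ⟨i, rfl⟩ := exists_eq_univ_erase hI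
    calc koszulDiff y b (Finset.univ.erase i)
        = ∑ j ∈ Finset.univ.erase i, sign i Finset.univ • (a i j * y j) := by
          rw [koszulDiff_apply]
          refine Finset.sum_congr rfl fun j hj => ?_
          rw [hba i j (Finset.ne_of_mem_erase hj).symm, smul_mul_assoc, smul_smul, mul_left_comm,
            sign_mul_self, mul_one]
      _ = sign i Finset.univ • ∑ j, a i j * y j := by
          rw [← Finset.smul_sum, Finset.sum_erase _ (by rw [ha0, zero_mul])]
      _ = e (Finset.univ.erase i) := by
          rw [← hea, smul_smul, sign_mul_self, one_smul]
  · rw [he I hI, koszulDiff_eq_zero_of_card_ne hb hI]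

end Koszul

section Fractions

variable {A : Type*} [CommRing A] {m : ℕ} (x : Fin m → A)

/-- The fraction `a / x_I ^ t`, linear in `a`. -/
noncomputable def frac (t : ℕ) (I : Finset (Fin m)) : A →ₗ[A] Loc x I :=
  LinearMap.toSpanSingleton A _ (IsLocalization.Away.invSelf (∏ l ∈ I, x l) ^ t)

/-- The Čech cochain with components `e_I / x_I ^ t`. -/
noncomputable def fracCochain (t : ℕ) : (Finset (Fin m) → A) →ₗ[A] Cochain x :=
  LinearMap.pi fun I => frac x t I ∘ₗ LinearMap.proj I

variable {x}

theorem fracCochain_apply (t : ℕ) (e : Finset (Fin m) → A) (I : Finset (Fin m)) :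
    fracCochain x t e I = frac x t I (e I) := rfl

theorem eq_frac_iff {t : ℕ} {I : Finset (Fin m)} {a : A} {z : Loc x I} :
    z = frac x t I a ↔
      z * algebraMap A (Loc x I) (∏ l ∈ I, x l) ^ t = algebraMap A (Loc x I) a := by
  have h : IsLocalization.Away.invSelf (S := Loc x I) (∏ l ∈ I, x l) ^ t *
      algebraMap A (Loc x I) (∏ l ∈ I, x l) ^ t = 1 := by
    rw [← mul_pow, mul_comm, IsLocalization.Away.mul_invSelf, one_pow]
  rw [frac, LinearMap.toSpanSingleton_apply, Algebra.smul_def]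
  constructor
  · rintro rfl
    rw [mul_assoc, h, mul_one]
  · intro hz
    rw [← hz, mul_assoc, mul_comm (_ ^ t), h, mul_one]

theorem frac_mul_algebraMap (t : ℕ) (I : Finset (Fin m)) (a : A) :
    frac x t I a * algebraMap A (Loc x I) (∏ l ∈ I, x l) ^ t = algebraMap A (Loc x I) a :=
  eq_frac_iff.mp rfl

theorem exists_eq_frac {I : Finset (Fin m)} (z : Loc x I) : ∃ t a, z = frac x t I a := by
  obtain ⟨t, a, h⟩ := IsLocalization.Away.surj (∏ l ∈ I, x l) z
  exact ⟨t, a, eq_frac_iff.mpr h⟩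

theorem exists_pow_mul_eq_of_frac_eq {t s : ℕ} {I : Finset (Fin m)} {a b : A}
    (h : frac x t I a = frac x s I b) :
    ∃ r, (∏ l ∈ I, x l) ^ (s + r) * a = (∏ l ∈ I, x l) ^ (t + r) * b := by
  obtain ⟨⟨_, r, rfl⟩, hr⟩ := IsLocalization.exists_of_eq
    (M := Submonoid.powers (∏ l ∈ I, x l)) (S := Loc x I)
    (show algebraMap A (Loc x I) ((∏ l ∈ I, x l) ^ s * a) =
        algebraMap A (Loc x I) ((∏ l ∈ I, x l) ^ t * b) by
      rw [map_mul, map_mul, map_pow, map_pow, ← frac_mul_algebraMap t I a,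
        ← frac_mul_algebraMap s I b, h]
      ring)
  exact ⟨r, by rw [pow_add, pow_add]; linear_combination hr⟩

theorem frac_pow_mul (t s : ℕ) (I : Finset (Fin m)) (a : A) :
    frac x (t + s) I ((∏ l ∈ I, x l) ^ s * a) = frac x t I a := by
  symm
  rw [eq_frac_iff, pow_add, ← mul_assoc, frac_mul_algebraMap, map_mul, map_pow, mul_comm]

theorem res_frac (t : ℕ) {j : Fin m} {J : Finset (Fin m)} (hj : j ∈ J) (a : A) :
    res x (Finset.erase_subset j J) (frac x t (J.erase j) a) = frac x t J (a * x j ^ t) := by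
  have h (b : A) : res x (Finset.erase_subset j J) (algebraMap A (Loc x (J.erase j)) b) =
      algebraMap A (Loc x J) b := AlgHom.commutes _ _
  have hJ : algebraMap A (Loc x J) (∏ l ∈ J, x l) =
      algebraMap A (Loc x J) (∏ l ∈ J.erase j, x l) * algebraMap A (Loc x J) (x j) := by
    rw [← map_mul, Finset.prod_erase_mul J x hj]
  rw [eq_frac_iff, hJ, mul_pow, ← h (∏ l ∈ _, x l), ← map_pow, ← mul_assoc, ← map_mul,
    frac_mul_algebraMap, h, map_mul, map_pow]

theorem frac_mul_pow_self (p t : ℕ) (I : Finset (Fin m)) (a : A) :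
    frac x (p * t) I (a ^ p) = frac x t I a ^ p := by
  symm
  rw [eq_frac_iff, mul_comm p t, pow_mul, ← mul_pow, frac_mul_algebraMap, map_pow]

theorem fracCochain_scale (t s : ℕ) (e : Finset (Fin m) → A) :
    fracCochain x (t + s) (scale (x ^ s) e) = fracCochain x t e := by
  funext I
  simp only [fracCochain_apply, scale_apply, Pi.pow_apply, Finset.prod_pow, frac_pow_mul]

theorem d_fracCochain (t : ℕ) (e : Finset (Fin m) → A) :
    d x (fracCochain x t e) = fracCochain x t (koszulDiff (x ^ t) e) := by
  funext J
  rw [fracCochain_apply, koszulDiff_apply, map_sum]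
  refine Finset.sum_congr rfl fun j hj => ?_
  rw [fracCochain_apply, res_frac t hj, map_zsmul, sign, Pi.pow_apply]

theorem frobCochain_fracCochain (k : Type*) [Field k] (p : ℕ) [Fact p.Prime] [CharP k p]
    [Algebra k A] (t : ℕ) (e : Finset (Fin m) → A) :
    frobCochain k p x (fracCochain x t e) = fracCochain x (p * t) (e ^ p) :=
  funext fun I => (frac_mul_pow_self p t I (e I)).symm

theorem exists_eq_fracCochain (c : Cochain x) : ∃ t e, c = fracCochain x t e := by
  choose t a h using fun I => exists_eq_frac (c I)
  refine ⟨∑ I, t I, fun I => (∏ l ∈ I, x l) ^ (∑ J, t J - t I) * a I, funext fun I => ?_⟩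
  obtain ⟨r, hr⟩ := Nat.exists_eq_add_of_le
    (Finset.single_le_sum (fun _ _ => Nat.zero_le _) (Finset.mem_univ I) : t I ≤ ∑ J, t J)
  rw [fracCochain_apply, hr, Nat.add_sub_cancel_left, frac_pow_mul, h I]

theorem exists_scale_eq_of_fracCochain_eq {t s : ℕ} {e e' : Finset (Fin m) → A}
    (h : fracCochain x t e = fracCochain x s e') :
    ∃ r, scale (x ^ (s + r)) e = scale (x ^ (t + r)) e' := by
  have hI (I : Finset (Fin m)) : frac x t I (e I) = frac x s I (e' I) := congrFun h I
  choose r hr using fun I => exists_pow_mul_eq_of_frac_eq (hI I)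
  refine ⟨∑ I, r I, funext fun I => ?_⟩
  obtain ⟨q, hq⟩ := Nat.exists_eq_add_of_le
    (Finset.single_le_sum (fun _ _ => Nat.zero_le _) (Finset.mem_univ I) : r I ≤ ∑ J, r J)
  simp only [scale_apply, Pi.pow_apply, Finset.prod_pow, hq, ← add_assoc]
  rw [pow_add _ (s + r I), pow_add _ (t + r I)]
  linear_combination (∏ l ∈ I, x l) ^ q * hr I

end Fractions

end Cech

section PowIdeal

open MvPolynomial

variable {σ k : Type*} [CommSemiring k]

/-- The ideal generated by the `t`-th powers of the variables in `S`. -/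
noncomputable def powIdeal (k : Type*) [CommSemiring k] (t : ℕ) (S : Set σ) :
    Ideal (MvPolynomial σ k) :=
  Ideal.span ((fun i => (X i : MvPolynomial σ k) ^ t) '' S)

theorem mem_powIdeal_iff {t : ℕ} {S : Set σ} {g : MvPolynomial σ k} :
    g ∈ powIdeal k t S ↔ ∀ b ∈ g.support, ∃ i ∈ S, t ≤ b i := by
  have h : powIdeal k t S =
      Ideal.span ((fun s => monomial s (1 : k)) '' ((fun i => Finsupp.single i t) '' S)) := by
    rw [powIdeal, Set.image_image]
    simp only [X_pow_eq_monomial]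
  rw [h, mem_ideal_span_monomial_image]
  simp

theorem mem_powIdeal_of_monomial_mul_mem {t s : ℕ} {S : Set σ} {c : σ →₀ ℕ}
    {g : MvPolynomial σ k} (hc : ∀ i ∈ S, c i ≤ s)
    (h : monomial c 1 * g ∈ powIdeal k (t + s) S) : g ∈ powIdeal k t S := by
  rw [mem_powIdeal_iff] at h ⊢
  intro b hb
  obtain ⟨i, hi, hti⟩ := h (c + b) (by
    rw [mem_support_iff, coeff_monomial_mul, one_mul]
    exact mem_support_iff.mp hb)
  have := hc i hi
  exact ⟨i, hi, by rw [Finsupp.add_apply] at hti; lia⟩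

theorem isWeaklyRegularFamily_X_pow {k : Type*} [CommRing k] (t : ℕ) :
    IsWeaklyRegularFamily (X ^ t : σ → MvPolynomial σ k) := by
  intro S j g hj h
  refine mem_powIdeal_of_monomial_mul_mem (t := t) (s := 0) (c := Finsupp.single j t)
    (fun i hi => ?_) ?_
  · rw [Finsupp.single_eq_of_ne (by rintro rfl; exact hj hi)]
  · rwa [← X_pow_eq_monomial, mul_comm]

/-- The exponent vector of `(∏ x_l) ^ i`; for `i = t - 1` its monomial spans the socle of the
quotient by all `x_l ^ t`. -/
noncomputable def constExponent (σ : Type*) [Finite σ] (i : ℕ) : σ →₀ ℕ :=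
  Finsupp.equivFunOnFinite.symm fun _ => i

theorem constExponent_apply [Finite σ] (i : ℕ) (l : σ) : constExponent σ i l = i := rfl

theorem prod_X_pow_eq_monomial_constExponent [Fintype σ] (s : ℕ) :
    ∏ i, (X i : MvPolynomial σ k) ^ s = monomial (constExponent σ s) 1 := by
  rw [monomial_eq, map_one, one_mul, Finsupp.prod_fintype _ _ (by simp)]
  simp [constExponent_apply]

end PowIdeal

/-! ### Duality modulo powers of the variables -/

section DegLE

open MvPolynomial

variable {σ k : Type*} [Field k]

/-- The polynomials of degree at most `M`; only `0` if the integer `M` is negative. -/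
noncomputable def degLE (σ k : Type*) [Field k] (M : ℤ) : Submodule k (MvPolynomial σ k) :=
  restrictSupport k {b | (b.degree : ℤ) ≤ M}

theorem mem_degLE {M : ℤ} {g : MvPolynomial σ k} :
    g ∈ degLE σ k M ↔ ∀ b ∈ g.support, (b.degree : ℤ) ≤ M :=
  Iff.rfl

theorem degLE_mono {M N : ℤ} (hMN : M ≤ N) : degLE σ k M ≤ degLE σ k N :=
  restrictSupport_mono k fun _ hb => hb.trans hMN

theorem mul_mem_degLE {M N : ℤ} {g h : MvPolynomial σ k} (hg : g ∈ degLE σ k M)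
    (hh : h ∈ degLE σ k N) : g * h ∈ degLE σ k (M + N) := by
  classical
  rw [mem_degLE] at *
  intro b hb
  obtain ⟨c, hc, e, he, rfl⟩ := Finset.mem_add.mp (support_mul g h hb)
  rw [map_add, Nat.cast_add]
  exact add_le_add (hg c hc) (hh e he)

theorem mem_degLE_of_isHomogeneous {D : ℕ} {g : MvPolynomial σ k} (hg : g.IsHomogeneous D) :
    g ∈ degLE σ k D := fun b hb => by
  rw [Set.mem_ofPred_eq, Finsupp.degree_apply, ← hg.degree_eq_sum_deg_support hb]

theorem prod_X_pow_mul_mem_degLE {M : ℤ} {g : MvPolynomial σ k} (hg : g ∈ degLE σ k M)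
    (I : Finset σ) (s : ℕ) : (∏ l ∈ I, X l ^ s) * g ∈ degLE σ k (M + s * I.card) := by
  have hX : (∏ l ∈ I, (X l : MvPolynomial σ k) ^ s).IsHomogeneous (∑ _ ∈ I, s) :=
    IsHomogeneous.prod I _ _ fun l _ => isHomogeneous_X_pow l s
  have := mul_mem_degLE (mem_degLE_of_isHomogeneous hX) hg
  rwa [Finset.sum_const, smul_eq_mul, mul_comm I.card, Nat.cast_mul, add_comm] at this

theorem mem_degLE_of_mul_mem {M : ℤ} {d : ℕ} {f h : MvPolynomial σ k} (hf0 : f ≠ 0)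
    (hf : f.IsHomogeneous d) (hfh : f * h ∈ degLE σ k M) : h ∈ degLE σ k (M - d) := by
  rw [mem_degLE] at *
  intro b hb
  have hb0 : homogeneousComponent b.degree h ≠ 0 := fun h0 => by
    have := congrArg (coeff b) h0
    rw [coeff_homogeneousComponent, if_pos rfl, coeff_zero] at this
    exact mem_support_iff.mp hb this
  have hfb : homogeneousComponent (d + b.degree) (f * h) ≠ 0 := by
    rw [homogeneousComponent_mul_of_isHomogeneous hf (Nat.le_add_right _ _),
      Nat.add_sub_cancel_left]
    exact mul_ne_zero hf0 hb0
  obtain ⟨c, hc⟩ := ne_zero_iff.mp hfb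
  rw [coeff_homogeneousComponent, ite_ne_right_iff] at hc
  have := hfh c (mem_support_iff.mpr hc.2)
  lia

theorem weight_one_int_eq_degree (b : σ →₀ ℕ) :
    Finsupp.weight (fun _ => (1 : ℤ)) b = b.degree := by
  simp [Finsupp.weight_apply, Finsupp.sum, Finsupp.degree_apply]

theorem mem_degLE_of_isWeightedHomogeneous {M : ℤ} {g : MvPolynomial σ k}
    (hg : IsWeightedHomogeneous (fun _ => (1 : ℤ)) g M) : g ∈ degLE σ k M := fun b hb => by
  rw [Set.mem_ofPred_eq, ← weight_one_int_eq_degree, hg (mem_support_iff.mp hb)]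

theorem isWeightedHomogeneous_of_isHomogeneous {M : ℕ} {g : MvPolynomial σ k}
    (hg : g.IsHomogeneous M) : IsWeightedHomogeneous (fun _ => (1 : ℤ)) g M := fun b hb => by
  rw [weight_one_int_eq_degree, Finsupp.degree_apply,
    ← hg.degree_eq_sum_deg_support (mem_support_iff.mpr hb)]

end DegLE

section Duality

open MvPolynomial

variable {σ k : Type*} [Field k]

theorem degree_constExponent [Fintype σ] (i : ℕ) :
    (constExponent σ i).degree = Fintype.card σ * i := by
  simp [Finsupp.degree_eq_sum, constExponent_apply]

theorem mem_powIdeal_univ_iff [Finite σ] {t : ℕ} {g : MvPolynomial σ k} :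
    g ∈ powIdeal k (t + 1) Set.univ ↔ ∀ b ≤ constExponent σ t, coeff b g = 0 := by
  rw [mem_powIdeal_iff]
  refine forall_congr' fun b => ?_
  rw [mem_support_iff, ← not_imp_not, not_not]
  simp [Finsupp.le_def, constExponent_apply]

theorem mem_powIdeal_of_forall_monomial_mul_mem [Fintype σ] {t : ℕ} {M : ℤ}
    {h : MvPolynomial σ k} (hh : h ∈ degLE σ k M)
    (hmul : ∀ a : σ →₀ ℕ, Fintype.card σ * t - M ≤ a.degree →
      monomial a 1 * h ∈ powIdeal k (t + 1) Set.univ) : h ∈ powIdeal k (t + 1) Set.univ := by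
  rw [mem_powIdeal_univ_iff]
  intro b hb
  by_contra h0
  have hdeg : (constExponent σ t - b).degree + b.degree = Fintype.card σ * t := by
    rw [← map_add, tsub_add_cancel_of_le hb, degree_constExponent]
  have hbM := mem_degLE.mp hh b (mem_support_iff.mpr h0)
  have hmem := hmul (constExponent σ t - b) (by lia)
  have hcoeff := coeff_monomial_mul b (constExponent σ t - b) 1 h
  rw [one_mul, tsub_add_cancel_of_le hb, mem_powIdeal_univ_iff.mp hmem _ le_rfl] at hcoeff
  exact h0 hcoeff.symm

theorem le_constExponent_degree [Finite σ] (b : σ →₀ ℕ) : b ≤ constExponent σ b.degree :=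
  fun l => b.le_degree l

theorem homogeneousComponent_monomial (i : ℕ) (a : σ →₀ ℕ) (r : k) :
    homogeneousComponent i (monomial a r) = if a.degree = i then monomial a r else 0 := by
  rw [homogeneousComponent_of_mem (isHomogeneous_monomial r rfl)]
  simp only [eq_comm]

variable [Fintype σ]

/-- The form that Macaulay's inverse system attaches to a linear functional `L` on the forms of
degree `i`: the coefficients of `L`, indexed by the complementary monomials in `(∏ x_l) ^ i`. -/
noncomputable def macaulayForm (i : ℕ) (L : MvPolynomial σ k →ₗ[k] k) : MvPolynomial σ k := by
  classical
  exact ∑ b ∈ Finset.univ.finsuppAntidiag i,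
    monomial (constExponent σ i - b) (L (monomial b 1))

theorem isHomogeneous_macaulayForm {i M : ℕ} (hM : M + i = Fintype.card σ * i)
    (L : MvPolynomial σ k →ₗ[k] k) : (macaulayForm i L).IsHomogeneous M := by
  classical
  refine IsHomogeneous.sum _ _ _ fun b hb => isHomogeneous_monomial _ ?_
  obtain rfl : b.degree = i := by simpa [Finsupp.degree_eq_sum] using hb
  have := degree_constExponent (σ := σ) b.degree
  rw [← tsub_add_cancel_of_le (le_constExponent_degree b), map_add] at this
  lia

theorem coeff_macaulayForm {i : ℕ} (L : MvPolynomial σ k →ₗ[k] k) {c : σ →₀ ℕ}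
    (hc : c ≤ constExponent σ i) : coeff c (macaulayForm i L) =
      if (constExponent σ i - c).degree = i then L (monomial (constExponent σ i - c) 1) else 0 := by
  classical
  have hT (b : σ →₀ ℕ) (hb : b.degree = i) :
      coeff c (monomial (constExponent σ i - b) (L (monomial b 1))) =
        if b = constExponent σ i - c then L (monomial b 1) else 0 := by
    have hbi : b ≤ constExponent σ i := hb ▸ le_constExponent_degree b
    rw [coeff_monomial]
    refine if_congr ⟨?_, ?_⟩ rfl rfl
    · rintro rfl
      exact (tsub_tsub_cancel_of_le hbi).symm
    · intro h
      rw [h, tsub_tsub_cancel_of_le hc]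
  rw [macaulayForm, coeff_sum, Finset.sum_congr rfl fun b hb => hT b (by
    simpa [Finsupp.degree_eq_sum] using hb), Finset.sum_ite_eq']
  simp [Finsupp.degree_eq_sum]

theorem coeff_mul_macaulayForm {i : ℕ} (L : MvPolynomial σ k →ₗ[k] k) {c : σ →₀ ℕ}
    (hc : c ≤ constExponent σ i) (g : MvPolynomial σ k) : coeff c (g * macaulayForm i L) =
      L (homogeneousComponent i (monomial (constExponent σ i - c) 1 * g)) := by
  induction g using MvPolynomial.induction_on' with
  | add g g' hg hg' => simp only [add_mul, mul_add, coeff_add, map_add, hg, hg']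
  | monomial a r =>
    rw [monomial_mul, one_mul, coeff_monomial_mul', homogeneousComponent_monomial]
    by_cases hac : a ≤ c
    · have hsub : constExponent σ i - (c - a) = constExponent σ i - c + a :=
        tsub_tsub_assoc hc hac
      rw [if_pos hac, coeff_macaulayForm L (tsub_le_self.trans hc), hsub, apply_ite L, map_zero,
        mul_ite, mul_zero, ← smul_eq_mul, ← map_smul, smul_monomial, smul_eq_mul, mul_one]
    · rw [if_neg hac, if_neg, map_zero]
      contrapose hac
      intro l
      have h1 := Finsupp.le_degree l (constExponent σ i - c + a)
      have h2 := hc l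
      rw [hac, Finsupp.add_apply, Finsupp.tsub_apply] at h1
      rw [constExponent_apply] at h1 h2
      lia

attribute [local instance] MvPolynomial.gradedAlgebra in
theorem exists_form_forall_mul_mem_powIdeal {I : Ideal (MvPolynomial σ k)}
    (hI : I.IsHomogeneous (homogeneousSubmodule σ k)) {a : σ →₀ ℕ} (ha : monomial a 1 ∉ I) :
    ∃ (M : ℕ) (h : MvPolynomial σ k), M + a.degree = Fintype.card σ * a.degree ∧
      h.IsHomogeneous M ∧ h ∉ powIdeal k (a.degree + 1) Set.univ ∧
      ∀ g ∈ I, g * h ∈ powIdeal k (a.degree + 1) Set.univ := by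
  obtain ⟨L, hLa, hL⟩ := Submodule.exists_dual_map_eq_bot_of_notMem
    (p := I.restrictScalars k) ha inferInstance
  have hLI (g : MvPolynomial σ k) (hg : g ∈ I) : L g = 0 :=
    (Submodule.eq_bot_iff _).mp hL _ (Submodule.mem_map_of_mem hg)
  have hM : (constExponent σ a.degree - a).degree + a.degree = Fintype.card σ * a.degree := by
    rw [← map_add, tsub_add_cancel_of_le (le_constExponent_degree a), degree_constExponent]
  refine ⟨_, macaulayForm a.degree L, hM, isHomogeneous_macaulayForm hM L, fun hmem => hLa ?_,
    fun g hg => mem_powIdeal_univ_iff.mpr fun c hc => ?_⟩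
  · have h0 := mem_powIdeal_univ_iff.mp hmem (constExponent σ a.degree - a) tsub_le_self
    rwa [coeff_macaulayForm L tsub_le_self, tsub_tsub_cancel_of_le (le_constExponent_degree a),
      if_pos rfl] at h0
  · rw [coeff_mul_macaulayForm L hc]
    exact hLI _ ((mem_iff_homogeneousComponent_mem hI _).mp (I.mul_mem_left _ hg) _)

end Duality

/-! ### Cohomology classes of a hypersurface -/

namespace Hypersurface

open MvPolynomial Cech

variable {k : Type u} [Field k] {n : ℕ} {f : MvPolynomial (Fin (n + 1)) k}

section Cochain

variable (f)

/-- The Čech cochain of `R/fR` with components `e_I / x_I ^ t`, additive in `e`. -/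
noncomputable def cochain (t : ℕ) :
    (Finset (Fin (n + 1)) → MvPolynomial (Fin (n + 1)) k) →+ Cochain (var f) :=
  (fracCochain (var f) t).toAddMonoidHom.comp
    ((Ideal.Quotient.mk (Ideal.span {f})).toAddMonoidHom.compLeft _)

variable {f}

theorem cochain_eq (t : ℕ) (e : Finset (Fin (n + 1)) → MvPolynomial (Fin (n + 1)) k) :
    cochain f t e = fracCochain (var f) t (Ideal.Quotient.mk (Ideal.span {f}) ∘ e) := rfl

theorem cochain_apply_eq_zero (t : ℕ)
    {e : Finset (Fin (n + 1)) → MvPolynomial (Fin (n + 1)) k} {I : Finset (Fin (n + 1))}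
    (h : e I = 0) : cochain f t e I = 0 := by
  rw [cochain_eq, fracCochain_apply, Function.comp_apply, h, map_zero, map_zero]

theorem mk_comp_X_pow (t : ℕ) : Ideal.Quotient.mk (Ideal.span {f}) ∘ (X ^ t) = var f ^ t :=
  funext fun i => map_pow _ (X i) t

theorem cochain_scale (t s : ℕ) (e : Finset (Fin (n + 1)) → MvPolynomial (Fin (n + 1)) k) :
    cochain f (t + s) (scale (X ^ s) e) = cochain f t e := by
  rw [cochain_eq, map_scale, mk_comp_X_pow, fracCochain_scale, cochain_eq]

theorem d_cochain (t : ℕ) (e : Finset (Fin (n + 1)) → MvPolynomial (Fin (n + 1)) k) :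
    d (var f) (cochain f t e) = cochain f t (koszulDiff (X ^ t) e) := by
  rw [cochain_eq, d_fracCochain, cochain_eq, map_koszulDiff, mk_comp_X_pow]

theorem cochain_eq_zero_of_forall_dvd (t : ℕ)
    {e : Finset (Fin (n + 1)) → MvPolynomial (Fin (n + 1)) k} (he : ∀ I, f ∣ e I) :
    cochain f t e = 0 := by
  have h : Ideal.Quotient.mk (Ideal.span {f}) ∘ e = 0 := funext fun I =>
    Ideal.Quotient.eq_zero_iff_dvd _ _ |>.mpr (he I)
  rw [cochain_eq, h, map_zero]

theorem exists_eq_cochain (c : Cochain (var f)) : ∃ t e, c = cochain f t e := by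
  obtain ⟨t, e, rfl⟩ := exists_eq_fracCochain c
  obtain ⟨e, rfl⟩ := Ideal.Quotient.mk_surjective.comp_left e
  exact ⟨t, e, rfl⟩

theorem exists_scale_eq_of_cochain_eq {t s : ℕ}
    {e e' : Finset (Fin (n + 1)) → MvPolynomial (Fin (n + 1)) k}
    (h : cochain f t e = cochain f s e') :
    ∃ r u, scale (X ^ (s + r)) e = scale (X ^ (t + r)) e' + f • u := by
  rw [cochain_eq, cochain_eq] at h
  obtain ⟨r, hr⟩ := exists_scale_eq_of_fracCochain_eq h
  rw [← mk_comp_X_pow, ← mk_comp_X_pow, ← map_scale, ← map_scale] at hr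
  have hdvd (I : Finset (Fin (n + 1))) :
      f ∣ scale (X ^ (s + r)) e I - scale (X ^ (t + r)) e' I :=
    Ideal.mem_span_singleton.mp (Ideal.Quotient.eq.mp (congrFun hr I))
  choose u hu using hdvd
  exact ⟨r, u, funext fun I => eq_add_of_sub_eq' (hu I)⟩

end Cochain

/-- The `e_I / x_I ^ t` are the components of a cocycle of degree `n`, and `h / (x_0 ⋯ x_n) ^ t`
represents its image under the connecting homomorphism `H^n(R/fR) → H^{n+1}(R)`. -/
structure IsNumerator (f : MvPolynomial (Fin (n + 1)) k) (t : ℕ)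
    (e : Finset (Fin (n + 1)) → MvPolynomial (Fin (n + 1)) k)
    (h : MvPolynomial (Fin (n + 1)) k) : Prop where
  apply_eq_zero (I : Finset (Fin (n + 1))) (hI : I.card ≠ n) : e I = 0
  koszulDiff_univ : koszulDiff (X ^ t) e Finset.univ = f * h

namespace IsNumerator

variable {t : ℕ} {e : Finset (Fin (n + 1)) → MvPolynomial (Fin (n + 1)) k}
  {h : MvPolynomial (Fin (n + 1)) k}

theorem mem_cocycles (he : IsNumerator f t e h) : cochain f t e ∈ cocycles (var f) n := by
  refine ⟨fun I hI => cochain_apply_eq_zero t (he.apply_eq_zero I hI), ?_⟩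
  rw [d_cochain]
  refine cochain_eq_zero_of_forall_dvd t fun J => ?_
  by_cases hJ : J.card = n + 1
  · have hJ' : J = Finset.univ := by rwa [← Finset.card_eq_iff_eq_univ, Fintype.card_fin]
    exact ⟨h, hJ' ▸ he.koszulDiff_univ⟩
  · rw [koszulDiff_eq_zero_of_card_ne (fun I hI => he.apply_eq_zero I (by simpa using hI)) hJ]
    exact dvd_zero f

/-- The class in `H^n(R/fR)` of the cocycle with components `e_I / x_I ^ t`. -/
noncomputable def cechClass (he : IsNumerator f t e h) : H f n :=
  Submodule.Quotient.mk ⟨cochain f t e, he.mem_cocycles⟩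

theorem cechClass_eq (he : IsNumerator f t e h) {c : cocycles (var f) n}
    (hc : (c : Cochain (var f)) = cochain f t e) : Submodule.Quotient.mk c = he.cechClass :=
  congrArg Submodule.Quotient.mk (Subtype.ext hc)

theorem scale (he : IsNumerator f t e h) (s : ℕ) :
    IsNumerator f (t + s) (Cech.scale (X ^ s) e) ((∏ i, X i ^ s) * h) where
  apply_eq_zero I hI := by rw [scale_apply, he.apply_eq_zero I hI, mul_zero]
  koszulDiff_univ := by
    rw [pow_add, koszulDiff_scale, scale_apply, he.koszulDiff_univ]
    simp only [Pi.pow_apply]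
    ring

theorem add {e' : Finset (Fin (n + 1)) → MvPolynomial (Fin (n + 1)) k}
    {h' : MvPolynomial (Fin (n + 1)) k} (he : IsNumerator f t e h) (he' : IsNumerator f t e' h') :
    IsNumerator f t (e + e') (h + h') where
  apply_eq_zero I hI := by
    rw [Pi.add_apply, he.apply_eq_zero I hI, he'.apply_eq_zero I hI, add_zero]
  koszulDiff_univ := by
    rw [map_add, Pi.add_apply, he.koszulDiff_univ, he'.koszulDiff_univ, mul_add]

theorem mem_powIdeal_of_cechClass_eq_zero (he : IsNumerator f t e h) (hf0 : f ≠ 0)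
    (h0 : he.cechClass = 0) : h ∈ powIdeal k t Set.univ := by
  obtain ⟨b, -, hb⟩ := (Submodule.Quotient.mk_eq_zero _).mp h0
  obtain ⟨s, β, rfl⟩ := exists_eq_cochain b
  rw [d_cochain, Submodule.subtype_apply] at hb
  obtain ⟨r, u, hu⟩ := exists_scale_eq_of_cochain_eq hb.symm
  have key : (∏ i, X i ^ (s + r)) * (f * h) =
      f * koszulDiff (X ^ (t + (s + r))) u Finset.univ :=
    calc (∏ i, X i ^ (s + r)) * (f * h)
        = koszulDiff (X ^ (t + (s + r))) (Cech.scale (X ^ (s + r)) e) Finset.univ :=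
          ((he.scale (s + r)).koszulDiff_univ.trans (by ring)).symm
      _ = f * koszulDiff (X ^ (t + (s + r))) u Finset.univ := by
          rw [hu, map_add, map_smul, add_left_comm t s r, pow_add X s, koszulDiff_scale,
            koszulDiff_koszulDiff, map_zero, zero_add]
          rfl
  refine mem_powIdeal_of_monomial_mul_mem (s := s + r) (c := constExponent _ (s + r))
    (fun i _ => le_rfl) ?_
  rw [← prod_X_pow_eq_monomial_constExponent,
    mul_left_cancel₀ hf0 ((mul_left_comm _ _ _).trans key), powIdeal, Set.image_univ]
  exact koszulDiff_mem_span_range _ _ _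

theorem cechClass_eq_zero_of_mem_powIdeal (he : IsNumerator f t e h)
    (hh : h ∈ powIdeal k t Set.univ) : he.cechClass = 0 := by
  rw [powIdeal, Set.image_univ] at hh
  obtain ⟨a, ha⟩ := Ideal.mem_span_range_iff_exists_fun.mp hh
  obtain ⟨w, hw, -, hwa⟩ := exists_koszulDiff_univ_eq (X ^ t) a
  obtain ⟨b, hb, hbe⟩ := exists_koszulDiff_eq (isWeaklyRegularFamily_X_pow (k := k) t)
    (e := e - f • w)
    (fun I hI => by
      rw [Pi.sub_apply, Pi.smul_apply, he.apply_eq_zero I hI, hw I hI, smul_zero, sub_zero])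
    (by
      rw [map_sub, map_smul, Pi.sub_apply, Pi.smul_apply, he.koszulDiff_univ, hwa, ← ha]
      exact sub_self _)
  refine (Submodule.Quotient.mk_eq_zero _).mpr ⟨cochain f t b, fun I hI =>
    cochain_apply_eq_zero t (hb I hI), ?_⟩
  · have hfw : cochain f t (f • w) = 0 :=
      cochain_eq_zero_of_forall_dvd t fun I => dvd_mul_right f (w I)
    rw [d_cochain, hbe, map_sub, hfw, sub_zero]
    rfl

theorem cechClass_eq_zero_iff (he : IsNumerator f t e h) (hf0 : f ≠ 0) :
    he.cechClass = 0 ↔ h ∈ powIdeal k t Set.univ :=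
  ⟨he.mem_powIdeal_of_cechClass_eq_zero hf0, he.cechClass_eq_zero_of_mem_powIdeal⟩

end IsNumerator

section Frobenius

variable {p : ℕ} [Fact p.Prime] [CharP k p] {ι : Type*} [Fintype ι]
  {φ : ι → MvPolynomial (Fin (n + 1)) k →+ MvPolynomial (Fin (n + 1)) k}
  {c : ι → MvPolynomial (Fin (n + 1)) k} {t : ℕ}
  {e : Finset (Fin (n + 1)) → MvPolynomial (Fin (n + 1)) k} {h : MvPolynomial (Fin (n + 1)) k}

theorem IsNumerator.pow (he : IsNumerator f t e h) :
    IsNumerator f (p * t) (e ^ p) (f ^ (p - 1) * h ^ p) where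
  apply_eq_zero I hI := by
    rw [Pi.pow_apply, he.apply_eq_zero I hI, zero_pow (Fact.out : p.Prime).ne_zero]
  koszulDiff_univ := by
    have hpow := map_koszulDiff (frobeniusOver k p (MvPolynomial (Fin (n + 1)) k)) (X ^ t) e
    have hX : frobeniusOver k p (MvPolynomial (Fin (n + 1)) k) ∘ (X ^ t) = X ^ (p * t) := by
      rw [mul_comm, pow_mul]
      rfl
    rw [hX] at hpow
    calc koszulDiff (X ^ (p * t)) (e ^ p) Finset.univ
        = koszulDiff (X ^ t) e Finset.univ ^ p := (congrFun hpow Finset.univ).symm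
      _ = f * (f ^ (p - 1) * h ^ p) := by
          rw [he.koszulDiff_univ, mul_pow, ← mul_assoc,
            mul_pow_sub_one (Fact.out : p.Prime).ne_zero]

theorem frobH_cechClass (he : IsNumerator f t e h) :
    frobH k p (var f) n he.cechClass = (he.pow (p := p)).cechClass := by
  refine he.pow.cechClass_eq (c := frobCocycles k p (var f) n ⟨_, he.mem_cocycles⟩) ?_
  refine (frobCochain_fracCochain k p t _).trans (congrArg _ (funext fun I => ?_))
  exact (map_pow (Ideal.Quotient.mk (Ideal.span {f})) (e I) p).symm

theorem powIdeal_mul_eq_map_frobeniusOver {σ : Type*} (t : ℕ) (S : Set σ) :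
    powIdeal k (p * t) S = (powIdeal k t S).map (frobeniusOver k p (MvPolynomial σ k)) := by
  rw [powIdeal, powIdeal, Ideal.map_span, Set.image_image]
  refine congrArg Ideal.span (Set.image_congr fun i _ => ?_)
  rw [mul_comm, pow_mul]
  rfl

theorem frobH_cechClass_eq_zero_iff (hφ : IsCartierCoordinates p φ c) (hf0 : f ≠ 0)
    (he : IsNumerator f t e h) : frobH k p (var f) n he.cechClass = 0 ↔
      ∀ g ∈ cartierIdeal φ (f ^ (p - 1)), g * h ∈ powIdeal k t Set.univ := by
  rw [frobH_cechClass, he.pow.cechClass_eq_zero_iff hf0, powIdeal_mul_eq_map_frobeniusOver,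
    ← hφ.cartierIdeal_le_iff k]
  have hcolon : (∀ g ∈ cartierIdeal φ (f ^ (p - 1)), g * h ∈ powIdeal k t Set.univ) ↔
      cartierIdeal φ (f ^ (p - 1)) ≤ (powIdeal k t Set.univ).colon {h} := by
    simp only [SetLike.le_def, Submodule.mem_colon_singleton, smul_eq_mul]
  rw [hcolon, cartierIdeal, cartierIdeal, Ideal.span_le, Ideal.span_le, Set.range_subset_iff,
    Set.range_subset_iff]
  refine forall_congr' fun i => ?_
  rw [SetLike.mem_coe, SetLike.mem_coe, Submodule.mem_colon_singleton, smul_eq_mul,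
    mul_comm (f ^ (p - 1)), hφ.isCartierLinear i, mul_comm h]

end Frobenius

section Degrees

variable {d t : ℕ} {e : Finset (Fin (n + 1)) → MvPolynomial (Fin (n + 1)) k}

theorem koszulDiff_X_pow_mem_degLE {N : ℤ} (he : ∀ I, e I ∈ degLE _ k (N + t * I.card))
    (J : Finset (Fin (n + 1))) : koszulDiff (X ^ t) e J ∈ degLE _ k (N + t * J.card) := by
  rw [koszulDiff_apply]
  refine Submodule.sum_mem _ fun j hj => zsmul_mem ?_ _
  have := mul_mem_degLE (he (J.erase j)) (mem_degLE_of_isHomogeneous (isHomogeneous_X_pow j t))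
  rwa [add_assoc, ← mul_add_one, ← Nat.cast_add_one, Finset.card_erase_add_one hj] at this

theorem IsNumerator.mem_degLE {h : MvPolynomial (Fin (n + 1)) k} (hf0 : f ≠ 0)
    (hf : f.IsHomogeneous d) (he : IsNumerator f t e h) {N : ℤ}
    (hN : ∀ I, e I ∈ degLE _ k (N + t * I.card)) : h ∈ degLE _ k (N + t * (n + 1) - d) := by
  refine mem_degLE_of_mul_mem hf0 hf ?_
  have := koszulDiff_X_pow_mem_degLE hN Finset.univ
  rwa [he.koszulDiff_univ, Finset.card_univ, Fintype.card_fin, Nat.cast_add_one] at this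

theorem exists_eq_cochain_of_mem_cochainDeg {j : ℤ} {z : Cochain (var f)}
    (hz : z ∈ cochainDeg f j) :
    ∃ (t : ℕ) (e : _), (∀ I, e I ∈ degLE _ k (j + t * I.card)) ∧ z = cochain f t e := by
  choose t g hg hzg using fun I => hz I (Set.mem_univ I)
  have hle (I) : t I ≤ ∑ J, t J :=
    Finset.single_le_sum (fun _ _ => Nat.zero_le _) (Finset.mem_univ I)
  refine ⟨∑ I, t I, fun I => (∏ l ∈ I, X l ^ (∑ J, t J - t I)) * g I, fun I => ?_,
    funext fun I => ?_⟩
  · have := prod_X_pow_mul_mem_degLE (mem_degLE_of_isWeightedHomogeneous (hg I)) I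
      (∑ J, t J - t I)
    rwa [add_assoc, ← add_mul, ← Nat.cast_add, Nat.add_sub_cancel' (hle I)] at this
  · have := frac_pow_mul (x := var f) (t I) (∑ J, t J - t I) I (Ideal.Quotient.mk _ (g I))
    rw [Nat.add_sub_cancel' (hle I), ← eq_frac_iff.mpr (hzg I)] at this
    rw [cochain_eq, fracCochain_apply, Function.comp_apply, Finset.prod_pow, map_mul, map_pow,
      map_prod]
    exact this.symm

theorem exists_isNumerator_of_eq_cochain {c : cocycles (var f) n}
    (hc : (c : Cochain (var f)) = cochain f t e) (he : ∀ I, I.card ≠ n → e I = 0) :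
    ∃ r h, ∃ he' : IsNumerator f (t + r) (scale (X ^ r) e) h,
      Submodule.Quotient.mk c = he'.cechClass := by
  have hd : cochain f t (koszulDiff (X ^ t) e) = cochain f 0 0 := by
    rw [← d_cochain, ← hc, map_zero]
    exact c.2.2
  obtain ⟨r, u, hu⟩ := exists_scale_eq_of_cochain_eq hd
  rw [map_zero, zero_add, zero_add] at hu
  have he' : IsNumerator f (t + r) (scale (X ^ r) e) (u Finset.univ) :=
    ⟨fun I hI => by rw [scale_apply, he I hI, mul_zero], by
      rw [pow_add, koszulDiff_scale, hu]
      rfl⟩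
  exact ⟨r, _, he', he'.cechClass_eq (hc.trans (cochain_scale t r e).symm)⟩

theorem exists_isNumerator_of_mem_HDeg (hf0 : f ≠ 0) (hf : f.IsHomogeneous d) {j : ℤ} {z : H f n}
    (hz : z ∈ HDeg f n j) : ∃ (t : ℕ) (e h : _) (he : IsNumerator f t e h),
      z = he.cechClass ∧ h ∈ degLE _ k (j + t * (n + 1) - d) := by
  obtain ⟨c, hc, rfl⟩ := hz
  obtain ⟨t, e, hdeg, hce⟩ := exists_eq_cochain_of_mem_cochainDeg hc
  let e' : Finset (Fin (n + 1)) → MvPolynomial (Fin (n + 1)) k :=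
    fun I => if I.card = n then e I else 0
  have hdeg' (I) : e' I ∈ degLE _ k (j + t * I.card) := by
    unfold e'
    split_ifs
    exacts [hdeg I, zero_mem _]
  have hce' : (c : Cochain (var f)) = cochain f t e' := by
    refine funext fun I => ?_
    by_cases hI : I.card = n
    · have heI : e' I = e I := if_pos hI
      rw [cochain_eq, fracCochain_apply, Function.comp_apply, heI]
      exact congrFun hce I
    · rw [c.2.1 I hI, cochain_apply_eq_zero t (if_neg hI)]
  obtain ⟨r, h, he, hz⟩ := exists_isNumerator_of_eq_cochain hce' fun I hI => if_neg hI
  refine ⟨_, _, h, he, hz, he.mem_degLE hf0 hf fun I => ?_⟩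
  have := prod_X_pow_mul_mem_degLE (hdeg' I) I r
  rwa [add_assoc, ← add_mul, ← Nat.cast_add] at this

theorem exists_isNumerator_of_mem_HLE (hf0 : f ≠ 0) (hf : f.IsHomogeneous d) {N : ℤ} {z : H f n}
    (hz : z ∈ HLE f n N) : ∃ (t : ℕ) (e h : _) (he : IsNumerator f t e h),
      z = he.cechClass ∧ h ∈ degLE _ k (N + t * (n + 1) - d) := by
  refine Submodule.iSup_induction _ (motive := fun z => ∃ (t : ℕ) (e h : _)
    (he : IsNumerator f t e h), z = he.cechClass ∧ h ∈ degLE _ k (N + t * (n + 1) - d)) hz ?_ ?_ ?_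
  · rintro ⟨j, hj⟩ y hy
    obtain ⟨t, e, h, he, rfl, hh⟩ := exists_isNumerator_of_mem_HDeg hf0 hf hy
    have hjN : j + t * (n + 1) - d ≤ N + t * (n + 1) - d := by
      gcongr
      exact hj
    exact ⟨t, e, h, he, rfl, degLE_mono hjN hh⟩
  · have h0 : IsNumerator f 0 0 0 := ⟨fun _ _ => rfl, by rw [map_zero, mul_zero]; rfl⟩
    exact ⟨0, 0, 0, h0, (h0.cechClass_eq_zero_of_mem_powIdeal (zero_mem _)).symm, zero_mem _⟩
  · rintro _ _ ⟨t, e, h, he, rfl, hh⟩ ⟨t', e', h', he', rfl, hh'⟩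
    have hadd : IsNumerator f (t + t') _ _ := (he.scale t').add (add_comm t' t ▸ he'.scale t)
    refine ⟨t + t', _, _, hadd, hadd.cechClass_eq ?_, add_mem ?_ ?_⟩
    · rw [map_add, cochain_scale, add_comm t t', cochain_scale]
      rfl
    · have := prod_X_pow_mul_mem_degLE hh Finset.univ t'
      rw [Finset.card_univ, Fintype.card_fin] at this
      convert this using 2
      push_cast
      ring
    · have := prod_X_pow_mul_mem_degLE hh' Finset.univ t
      rw [Finset.card_univ, Fintype.card_fin] at this
      convert this using 2
      push_cast
      ring

theorem exists_isNumerator_cechClass_mem_HDeg {h : MvPolynomial (Fin (n + 1)) k} {M : ℕ}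
    (hf : f.IsHomogeneous d) (hh : h.IsHomogeneous M) (htM : t ≤ d + M)
    (hfh : f * h ∈ powIdeal k t Set.univ) :
    ∃ e, ∃ he : IsNumerator f t e h, he.cechClass ∈ HDeg f n (d + M - t * (n + 1)) := by
  rw [powIdeal, Set.image_univ] at hfh
  obtain ⟨a, ha, hsum⟩ := exists_isHomogeneous_sum_mul_eq
    (fun i => isHomogeneous_X_pow i t) hfh (hf.mul hh) htM
  obtain ⟨w, hw, hwa, hwh⟩ := exists_koszulDiff_univ_eq (X ^ t) a
  have he : IsNumerator f t w h := ⟨hw, hwh.trans hsum⟩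
  refine ⟨w, he, ⟨_, he.mem_cocycles⟩, fun I _ => ⟨t, w I, ?_, frac_mul_algebraMap _ _ _⟩, rfl⟩
  by_cases hI : I.card = n
  · obtain ⟨i, rfl⟩ := exists_eq_univ_erase hI
    have := (mem_weightedHomogeneousSubmodule k _ _ _).mpr
      (isWeightedHomogeneous_of_isHomogeneous (ha i))
    have hdeg : (d + M - t * (n + 1) : ℤ) + t * n = (d + M - t : ℕ) := by
      rw [Nat.cast_sub htM]
      push_cast
      ring
    rw [hwa, hI, hdeg]
    exact zsmul_mem this _
  · rw [hw I hI]
    exact isWeightedHomogeneous_zero _ _ _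

end Degrees

end Hypersurface

/-! ### Isolated non-F-pure points -/

section CartierIdeal

open MvPolynomial

variable {σ ι k : Type*} [Field k] {φ : ι → MvPolynomial σ k →+ MvPolynomial σ k}

theorem exists_isHomogeneous_le_sub_one {p : ℕ} [Fact p.Prime] {f : MvPolynomial σ k} {d : ℕ}
    (hf : f.IsHomogeneous d)
    (hdeg : ∀ i g D, g.IsHomogeneous D → ∃ m, p * m ≤ D ∧ (φ i g).IsHomogeneous m) (i : ι) :
    ∃ m ≤ d - 1, (φ i (f ^ (p - 1))).IsHomogeneous m := by
  obtain ⟨m, hm, hhom⟩ := hdeg i _ _ (hf.pow (p - 1))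
  refine ⟨m, ?_, hhom⟩
  by_contra! hlt
  have hp : 1 < p := (Fact.out : p.Prime).one_lt
  have hdm : d * (p - 1) ≤ m * (p - 1) := Nat.mul_le_mul_right _ (by omega)
  rw [Nat.mul_sub m, mul_comm m p] at hdm
  have : p * 1 ≤ p * m := Nat.mul_le_mul_left p (by omega)
  omega

attribute [local instance] MvPolynomial.gradedAlgebra in
theorem isHomogeneous_cartierIdeal {g : MvPolynomial σ k}
    (hgen : ∀ i, ∃ m, (φ i g).IsHomogeneous m) :
    (cartierIdeal φ g).IsHomogeneous (homogeneousSubmodule σ k) := by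
  refine Ideal.homogeneous_span _ _ ?_
  rintro _ ⟨i, rfl⟩
  exact hgen i

end CartierIdeal

namespace Hypersurface

open MvPolynomial

variable {k : Type u} [Field k] {n : ℕ} {f : MvPolynomial (Fin (n + 1)) k} {p : ℕ}
  [Fact p.Prime] [CharP k p] {ι : Type*} [Fintype ι]
  {φ : ι → MvPolynomial (Fin (n + 1)) k →+ MvPolynomial (Fin (n + 1)) k}
  {c : ι → MvPolynomial (Fin (n + 1)) k} {d : ℕ}

theorem injective_frobeniusLE (hφ : IsCartierCoordinates p φ c) (hf0 : f ≠ 0)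
    (hf : f.IsHomogeneous d) {N : ℤ} (hJ : ∀ a : Fin (n + 1) →₀ ℕ, d - N - (n + 1) ≤ a.degree →
      monomial a 1 ∈ cartierIdeal φ (f ^ (p - 1))) :
    Function.Injective (frobeniusLE f p n N) := by
  refine (injective_iff_map_eq_zero _).mpr fun ⟨z, hz⟩ h0 => Subtype.ext ?_
  obtain ⟨t, e, h, he, rfl, hdeg⟩ := exists_isNumerator_of_mem_HLE hf0 hf hz
  have hmul := (frobH_cechClass_eq_zero_iff hφ hf0 he).mp (congrArg Subtype.val h0)
  refine (he.cechClass_eq_zero_iff hf0).mpr ?_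
  rcases t with _ | t
  · exact mem_powIdeal_iff.mpr fun b _ => ⟨0, Set.mem_univ 0, Nat.zero_le _⟩
  · refine mem_powIdeal_of_forall_monomial_mul_mem hdeg fun a ha => hmul _ (hJ a ?_)
    rw [Fintype.card_fin] at ha
    push_cast at ha
    linarith

attribute [local instance] MvPolynomial.gradedAlgebra in
theorem monomial_mem_cartierIdeal_of_injective_frobeniusLE (hφ : IsCartierCoordinates p φ c)
    (hf0 : f ≠ 0) (hf : f.IsHomogeneous d) {N : ℤ}
    (hJ : (cartierIdeal φ (f ^ (p - 1))).IsHomogeneous (homogeneousSubmodule (Fin (n + 1)) k))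
    (hinj : Function.Injective (frobeniusLE f p n N)) {a : Fin (n + 1) →₀ ℕ}
    (ha : d - N - (n + 1) ≤ a.degree) (had : a.degree + 1 ≤ d + n * a.degree) :
    monomial a 1 ∈ cartierIdeal φ (f ^ (p - 1)) := by
  by_contra hnot
  obtain ⟨M, h, hM, hh, hh0, hJh⟩ := exists_form_forall_mul_mem_powIdeal hJ hnot
  obtain rfl : M = n * a.degree := by
    rw [Fintype.card_fin, add_one_mul] at hM
    omega
  obtain ⟨e, he, hdeg⟩ := exists_isNumerator_cechClass_mem_HDeg hf hh had
    (hJh f (hφ.mem_cartierIdeal_pow_sub_one k f))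
  have hHLE : he.cechClass ∈ HLE f n N := by
    refine Submodule.mem_iSup_of_mem (p := fun j : Set.Iic N => HDeg f n j) ⟨_, ?_⟩ hdeg
    rw [Set.mem_Iic]
    push_cast
    linarith
  have hzero : (⟨he.cechClass, hHLE⟩ : HLE f n N) = 0 :=
    (injective_iff_map_eq_zero _).mp hinj _
      (Subtype.ext ((frobH_cechClass_eq_zero_iff hφ hf0 he).mpr hJh))
  exact hh0 ((he.cechClass_eq_zero_iff hf0).mp (congrArg Subtype.val hzero))

theorem two_le_of_cartierIdeal_le_maxIdeal (hφ : IsCartierCoordinates p φ c) (hf0 : f ≠ 0)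
    (hgen : ∀ i, ∃ m ≤ d - 1, (φ i (f ^ (p - 1))).IsHomogeneous m)
    (hJ : cartierIdeal φ (f ^ (p - 1)) ≤ maxIdeal k n) : 2 ≤ d := by
  by_contra! hd
  have hzero (i : ι) : φ i (f ^ (p - 1)) = 0 := by
    obtain ⟨m, hm, hhom⟩ := hgen i
    have hmem : φ i (f ^ (p - 1)) ∈ idealOfVars (Fin (n + 1)) k ^ 1 := by
      rw [pow_one]
      exact hJ (Ideal.subset_span (Set.mem_range_self i))
    rw [← support_eq_empty, Finset.eq_empty_iff_forall_notMem]
    intro b hb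
    have h1 := (mem_pow_idealOfVars_iff 1 _).mp hmem b hb
    rw [Finsupp.degree_apply, ← hhom.degree_eq_sum_deg_support hb] at h1
    omega
  have hbot : cartierIdeal φ (f ^ (p - 1)) = ⊥ := by
    rw [cartierIdeal, Ideal.span_eq_bot]
    rintro _ ⟨i, rfl⟩
    exact hzero i
  exact hf0 ((Submodule.mem_bot _).mp (hbot ▸ hφ.mem_cartierIdeal_pow_sub_one k f))

attribute [local instance] MvPolynomial.gradedAlgebra in
theorem hasIsolatedNonFPurePoint_iff (hφ : IsCartierCoordinates p φ c) (hf0 : f ≠ 0)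
    (hm : ¬ IsFPure k p (LocAt f (maxIdeal k n)))
    (hJ : (cartierIdeal φ (f ^ (p - 1))).IsHomogeneous (homogeneousSubmodule (Fin (n + 1)) k)) :
    HasIsolatedNonFPurePoint p f ↔ ∃ s, maxIdeal k n ^ s ≤ cartierIdeal φ (f ^ (p - 1)) := by
  refine Iff.trans ?_ (forall_prime_lt_idealOfVars_iff hJ)
  simp only [HasIsolatedNonFPurePoint, hm, not_false_eq_true, true_and,
    isFPure_locAt_iff _ hφ hf0]
  rfl

theorem injective_frobeniusLE_iff (hφ : IsCartierCoordinates p φ c) (hf0 : f ≠ 0)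
    (hf : f.IsHomogeneous d) (hd : 2 ≤ d)
    (hgen : ∀ i, ∃ m ≤ d - 1, (φ i (f ^ (p - 1))).IsHomogeneous m) :
    Function.Injective (frobeniusLE f p n (-((n : ℤ) * ((d : ℤ) - 1)))) ↔
      ∃ s, maxIdeal k n ^ s ≤ cartierIdeal φ (f ^ (p - 1)) := by
  have hD := Nat.exists_eq_add_of_le' hd
  obtain ⟨D, rfl⟩ := hD
  constructor
  · intro hinj
    refine ⟨(n + 1) * D + 1, (pow_idealOfVars_eq_span _).trans_le (Ideal.span_le.mpr ?_)⟩
    rintro _ ⟨a, ha : a.degree = _, rfl⟩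
    refine monomial_mem_cartierIdeal_of_injective_frobeniusLE hφ hf0 hf
      (isHomogeneous_cartierIdeal fun i => (hgen i).imp fun _ h => h.2) hinj ?_ ?_
    · rw [ha]
      push_cast
      linarith
    · rcases Nat.eq_zero_or_pos n with rfl | hn
      · rw [ha]
        omega
      · have := Nat.le_mul_of_pos_left a.degree hn
        omega
  · rintro ⟨s, hs⟩
    refine injective_frobeniusLE hφ hf0 hf fun a ha =>
      monomial_mem_span_of_pow_le p D.succ_pos hgen hs ?_
    rw [Nat.succ_sub_one]
    push_cast at ha
    zify
    linarith

end Hypersurface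

theorem corollary2 {k : Type u} [Field k] (p : ℕ) [Fact p.Prime] [CharP k p]
    (hk : (frobenius k p).Finite) (n d : ℕ) (f : MvPolynomial (Fin (n + 1)) k)
    (hf : f.IsHomogeneous d)
    (hm : ¬ IsFPure k p (Hypersurface.LocAt f (Hypersurface.maxIdeal k n))) :
    Hypersurface.HasIsolatedNonFPurePoint p f ↔
      Function.Injective
        (Hypersurface.frobeniusLE f p n (-((n : ℤ) * ((d : ℤ) - 1)))) := by
  have hcoord := exists_isCartierCoordinates (σ := Fin (n + 1)) hk
  obtain ⟨ι, _, φ, c, hφ, hdeg⟩ := hcoord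
  have hf0 : f ≠ 0 := by
    rintro rfl
    exact hm (Hypersurface.isFPure_locAt_zero _ hφ)
  have hgen := exists_isHomogeneous_le_sub_one hf hdeg
  have hJ := isHomogeneous_cartierIdeal fun i => (hgen i).imp fun _ h => h.2
  have hd : 2 ≤ d := Hypersurface.two_le_of_cartierIdeal_le_maxIdeal hφ hf0 hgen
    (not_not.mp ((Hypersurface.isFPure_locAt_iff _ hφ hf0).not.mp hm))
  exact (Hypersurface.hasIsolatedNonFPurePoint_iff hφ hf0 hm hJ).trans
    (Hypersurface.injective_frobeniusLE_iff hφ hf0 hf hd hgen).symm
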